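/- Let $A$ be a C$^*$-algebra with multiplier algebra $M(A)$. A strongly continuous one-parameter representation on $A$ is a family $\alpha=(\alpha_t)_{t\in\mathbb R}$ of bounded linear operators on $A$ with $\alpha_{s+t}=\alpha_s\alpha_t$, $\alpha_0=\mathrm{id}$, $\|\alpha_t\|\le 1$, such that $t\mapsto\alpha_t(a)$ is norm continuous for every $a\in A$. It is called semi-multiplicative if there are strongly continuous one-parameter representations $\beta,\gamma$ on $A$ with $\beta_t(b)\,\alpha_t(a)=\alpha_t(ba)$ and $\alpha_t(a)\,\gamma_t(b)=\alpha_t(ab)$ for all $a,b\in A$, $t\in\mathbb R$ (for example, every strongly continuous one-parameter group of $*$-automorphisms of $A$ is semi-multiplicative). The strict topology on $M(A)$ is the coarsest topology for which all maps $m\mapsto mb$ and $m\mapsto bm$ ($b\in A$) from $M(A)$ into $A$ with its norm topology are continuous. If $\alpha$ is semi-multiplicative, each $\alpha_t$ has a unique linear extension $\overline{\alpha_t}:M(A)\to M(A)$ that is strictly continuous on norm bounded subsets of $M(A)$. For $z\in\mathbb C$ let $S(z)$ be the closed horizontal strip of all $y\in\mathbb C$ with $\operatorname{Im}y$ between $0$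 and $\operatorname{Im}z$ (inclusive), and $S(z)^0$ its interior. Let $\alpha_z$ be the linear operator in $A$ whose domain $D(\alpha_z)$ consists of the $a\in A$ for which there is a function $f:S(z)\to A$ that is norm continuous on $S(z)$, analytic on $S(z)^0$ and satisfies $f(t)=\alpha_t(a)$ for all $t\in\mathbb R$, with $\alpha_z(a)=f(z)$. Let $\overline{\alpha}_z$ be the linear operator in $M(A)$ whose domain consists of the $a\in M(A)$ for which there is a function $f:S(z)\to M(A)$ that is strictly continuous on $S(z)$, (norm) analytic on $S(z)^0$ and satisfies $f(t)=\overline{\alpha_t}(a)$ for all $t\in\mathbb R$, with $\overline{\alpha}_z(a)=f(z)$. In both cases $f$ is unique. **Theorem.** Let $\alpha$ be a strongly continuous, semi-multiplicative one-parameter representation on a C$^*$-algebra $A$, and let $z\in\mathbb C$. Then $\overline{\alpha}_z$ is strictly closed, i.e. its graph is closed in $M(A)\times M(A)$ for the product of the strict topologies, and $D(\alpha_z)\subseteq A\subseteq M(A)$ is a strict core for $\overline{\alpha}_z$. Moreover $\alpha_z$, regarded as an operator in $M(A)$, is strictly closable, and its strict closure $\tau_z$ equals $\overline{\alpha}_z$.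 -/

import Mathlib

open scoped MultiplierAlgebra Topology

namespace StrictContinuation

/-! ### One-parameter representations -/

/-- A one-parameter representation on `E`: a group homomorphism from `ℝ` into the contractions
of `E`. -/
structure OneParamRep (E : Type*) [NormedAddCommGroup E] [NormedSpace ℂ E] where
  toFun : ℝ → E →L[ℂ] E
  map_add : ∀ s t, toFun (s + t) = (toFun s).comp (toFun t)
  map_zero : toFun 0 = ContinuousLinearMap.id ℂ E
  norm_le_one : ∀ t, ‖toFun t‖ ≤ 1

instance {E : Type*} [NormedAddCommGroup E] [NormedSpace ℂ E] :
    CoeFun (OneParamRep E) (fun _ => ℝ → E →L[ℂ] E) := ⟨OneParamRep.toFun⟩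

/-- Strong continuity: every orbit map is norm continuous. -/
def OneParamRep.StronglyContinuous {E : Type*} [NormedAddCommGroup E] [NormedSpace ℂ E]
    (α : OneParamRep E) : Prop :=
  ∀ a : E, Continuous fun t : ℝ => α t a

/-- Semi-multiplicativity of a one-parameter representation on a C⋆-algebra. -/
def OneParamRep.SemiMultiplicative {A : Type*} [NonUnitalCStarAlgebra A]
    (α : OneParamRep A) : Prop :=
  ∃ β γ : OneParamRep A, β.StronglyContinuous ∧ γ.StronglyContinuous ∧
    ∀ (t : ℝ) (a b : A), β t b * α t a = α t (b * a) ∧ α t a * γ t b = α t (a * b)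

theorem OneParamRep.apply_neg_apply {E : Type*} [NormedAddCommGroup E] [NormedSpace ℂ E]
    (α : OneParamRep E) (t : ℝ) (a : E) : α t (α (-t) a) = a := by
  have h := α.map_add t (-t)
  rw [add_neg_cancel, α.map_zero] at h
  exact (DFunLike.congr_fun h a).symm

/-- Multiplicative representations, e.g. groups of ⋆-automorphisms, are semi-multiplicative. -/
theorem OneParamRep.SemiMultiplicative.of_map_mul {A : Type*} [NonUnitalCStarAlgebra A]
    {α : OneParamRep A} (hα : α.StronglyContinuous)
    (hmul : ∀ (t : ℝ) (a b : A), α t (a * b) = α t a * α t b) : α.SemiMultiplicative :=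
  ⟨α, α, hα, hα, fun t a b => ⟨(hmul t b a).symm, (hmul t a b).symm⟩⟩

/-! ### The closed horizontal strip and uniqueness of analytic continuation -/

/-- The closed horizontal strip between the real axis and the horizontal line through `z`
(above or below the real axis, according to the sign of `Im z`). -/
def strip (z : ℂ) : Set ℂ := {y | y.im ∈ Set.uIcc 0 z.im}

theorem ofReal_mem_strip (z : ℂ) (t : ℝ) : (t : ℂ) ∈ strip z := by simp [strip]

theorem self_mem_strip (z : ℂ) : z ∈ strip z := by simp [strip]

theorem interior_strip (z : ℂ) : interior (strip z) =
    {y : ℂ | y.im ∈ Set.Ioo (min 0 z.im) (max 0 z.im)} := by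
  have : strip z = Complex.im ⁻¹' Set.Icc (min 0 z.im) (max 0 z.im) := rfl
  rw [this, Complex.interior_preimage_im, interior_Icc]
  rfl

/-- A function vanishing on the bottom side of a square vanishes at its centre. -/
theorem eq_zero_at_center {f : ℂ → ℂ} {h : ℝ}
    (hc : ContinuousOn f {w : ℂ | w.im ∈ Set.Icc 0 h})
    (hd : DifferentiableOn ℂ f {w : ℂ | w.im ∈ Set.Ioo 0 h})
    (h0 : ∀ t : ℝ, f t = 0) (p : ℂ) (hp : 0 < p.im) (hp' : 2 * p.im ≤ h) : f p = 0 := by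
  set s := p.im with hs
  set Q : Set ℂ := Set.Ioo (-s) s ×ℂ Set.Ioo (-s) s with hQ
  have hcl : closure Q = Set.Icc (-s) s ×ℂ Set.Icc (-s) s := by
    rw [hQ, Complex.closure_reProdIm, closure_Ioo (by linarith)]
  have hQo : IsOpen Q := isOpen_Ioo.reProdIm isOpen_Ioo
  have key : ∀ c : ℂ, (∀ u ∈ closure Q, c * u ∈ closure Q) → (∀ u ∈ Q, c * u ∈ Q) →
      DiffContOnCl ℂ (fun u => f (p + c * u)) Q := by
    intro c h1 h2
    refine ⟨?_, ?_⟩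
    · refine hd.comp (by fun_prop) ?_
      intro u hu
      have := (h2 u hu).2
      simp only [Set.mem_preimage, Set.mem_Ioo] at this
      simp only [Set.mem_ofPred_eq, Complex.add_im, Set.mem_Ioo]
      constructor <;> linarith [this.1, this.2]
    · refine hc.comp (by fun_prop) ?_
      intro u hu
      have hcu := h1 u hu
      rw [hcl] at hcu
      have := hcu.2
      simp only [Set.mem_preimage, Set.mem_Icc] at this
      simp only [Set.mem_ofPred_eq, Complex.add_im, Set.mem_Icc]
      constructor <;> linarith [this.1, this.2]
  have k1 := key 1 (by simp) (by simp)
  have k2 := key Complex.I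
    (by rw [hcl]; intro u hu; simp only [Complex.mem_reProdIm, Set.mem_Icc] at hu ⊢
        simp; grind)
    (by intro u hu; simp only [hQ, Complex.mem_reProdIm, Set.mem_Ioo] at hu ⊢
        simp; grind)
  have k3 := key (-1)
    (by rw [hcl]; intro u hu; simp only [Complex.mem_reProdIm, Set.mem_Icc] at hu ⊢
        simp; grind)
    (by intro u hu; simp only [hQ, Complex.mem_reProdIm, Set.mem_Ioo] at hu ⊢
        simp; grind)
  have k4 := key (-Complex.I)
    (by rw [hcl]; intro u hu; simp only [Complex.mem_reProdIm, Set.mem_Icc] at hu ⊢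
        simp; grind)
    (by intro u hu; simp only [hQ, Complex.mem_reProdIm, Set.mem_Ioo] at hu ⊢
        simp; grind)
  have kF := ((k1.smul k2).smul k3).smul k4
  have hb : Bornology.IsBounded Q := by
    exact (Metric.isBounded_Ioo _ _).reProdIm (Metric.isBounded_Ioo _ _)
  have hz : ∀ w : ℂ, w.im = 0 → f w = 0 := by
    intro w hw
    rw [← h0 w.re]
    congr 1
    exact Complex.ext (by simp) (by simp [hw])
  have hE := Complex.eqOn_of_eqOn_frontier hb kF (diffContOnCl_const (c := (0 : ℂ))) (by
    intro u hu
    rw [frontier, hQo.interior_eq, hcl, hQ] at hu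
    simp only [Set.mem_sdiff, Complex.mem_reProdIm, Set.mem_Icc, Set.mem_Ioo] at hu
    obtain ⟨⟨⟨a1, a2⟩, b1, b2⟩, hn⟩ := hu
    simp only [smul_eq_mul, mul_eq_zero]
    have : u.re = -s ∨ u.re = s ∨ u.im = -s ∨ u.im = s := by grind
    rcases this with e | e | e | e
    · exact Or.inl (Or.inl (Or.inr (hz _ (by simp [e, ← hs]))))
    · exact Or.inr (hz _ (by simp [e, ← hs]))
    · exact Or.inl (Or.inl (Or.inl (hz _ (by simp [e, ← hs]))))
    · exact Or.inl (Or.inr (hz _ (by simp [e, ← hs]))))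
  have h00 : (0 : ℂ) ∈ Q := by simp [hQ, Complex.mem_reProdIm, hp]
  have := hE h00
  simpa using this

theorem eqOn_zero_of_scalar {f : ℂ → ℂ} {h : ℝ} (hh : 0 < h)
    (hc : ContinuousOn f {w : ℂ | w.im ∈ Set.Icc 0 h})
    (hd : AnalyticOnNhd ℂ f {w : ℂ | w.im ∈ Set.Ioo 0 h})
    (h0 : ∀ t : ℝ, f t = 0) : Set.EqOn f 0 {w : ℂ | w.im ∈ Set.Icc 0 h} := by
  have hpre : IsPreconnected {w : ℂ | w.im ∈ Set.Ioo 0 h} := by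
    have : Convex ℝ (Complex.im ⁻¹' Set.Ioo 0 h) :=
      (convex_Ioo 0 h).is_linear_preimage (f := Complex.im) Complex.imLm.isLinear
    exact this.isPreconnected
  have hev : f =ᶠ[𝓝 (⟨0, h / 4⟩ : ℂ)] 0 := by
    have ho : IsOpen {w : ℂ | w.im ∈ Set.Ioo 0 (h / 2)} :=
      isOpen_Ioo.preimage Complex.continuous_im
    filter_upwards [ho.mem_nhds (show (⟨0, h / 4⟩ : ℂ) ∈ _ by
      simp only [Set.mem_ofPred_eq, Set.mem_Ioo]; constructor <;> linarith)] with w hw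
    exact eq_zero_at_center hc hd.differentiableOn h0 w hw.1 (by linarith [hw.2])
  have hin : Set.EqOn f 0 {w : ℂ | w.im ∈ Set.Ioo 0 h} :=
    hd.eqOn_zero_of_preconnected_of_eventuallyEq_zero hpre
      (show (⟨0, h / 4⟩ : ℂ) ∈ _ by
        simp only [Set.mem_ofPred_eq, Set.mem_Ioo]; constructor <;> linarith) hev
  refine hin.of_subset_closure hc continuousOn_const
    (fun w hw => Set.Ioo_subset_Icc_self hw) ?_
  have : closure (Complex.im ⁻¹' Set.Ioo 0 h) = Complex.im ⁻¹' Set.Icc 0 h := by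
    rw [Complex.closure_preimage_im, closure_Ioo hh.ne]
  exact this.ge

/-- A function that is continuous on a strip, analytic on its interior and zero on the real axis
vanishes on the strip. -/
theorem eqOn_zero_strip {E : Type*} [NormedAddCommGroup E] [NormedSpace ℂ E] {f : ℂ → E} {z : ℂ}
    (hc : ContinuousOn f (strip z)) (hd : AnalyticOnNhd ℂ f (interior (strip z)))
    (h0 : ∀ t : ℝ, f t = 0) : Set.EqOn f 0 (strip z) := by
  intro w hw
  refine SeparatingDual.eq_zero_of_forall_dual_eq_zero (R := ℂ) fun l => ?_
  rw [interior_strip] at hd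
  have hld : AnalyticOnNhd ℂ (fun u => l (f u)) _ := fun u hu => (l.analyticAt _).comp (hd u hu)
  have hlc : ContinuousOn (fun u => l (f u)) _ := l.continuous.comp_continuousOn hc
  have hl0 : ∀ t : ℝ, l (f t) = 0 := fun t => by rw [h0, map_zero]
  rcases lt_trichotomy z.im 0 with hz | hz | hz
  · have e : Set.uIcc 0 z.im = Set.Icc z.im 0 := Set.uIcc_of_ge hz.le
    simp only [strip, e] at hlc hw
    rw [min_eq_right hz.le, max_eq_left hz.le] at hld
    have := eqOn_zero_of_scalar (f := fun u => l (f (-u))) (h := -z.im) (by linarith)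
      (hlc.comp continuous_neg.continuousOn (fun u hu => by
        simp only [Set.mem_ofPred_eq, Set.mem_Icc, Complex.neg_im] at hu ⊢
        constructor <;> linarith [hu.1, hu.2]))
      (hld.comp (g := fun u => l (f u)) (f := fun u : ℂ => -u) (analyticOnNhd_id.neg)
        (fun u hu => by
        simp only [Set.mem_ofPred_eq, Set.mem_Ioo, Complex.neg_im] at hu ⊢
        constructor <;> linarith [hu.1, hu.2]))
      (fun t => by simpa using hl0 (-t))
    have h2 := this (x := -w) (by
      simp only [Set.mem_ofPred_eq, Set.mem_Icc, Complex.neg_im] at hw ⊢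
      constructor <;> linarith [hw.1, hw.2])
    simpa using h2
  · simp only [strip, hz, Set.uIcc_self, Set.mem_singleton_iff, Set.mem_ofPred_eq] at hw
    have : w = (w.re : ℂ) := Complex.ext (by simp) (by simp [hw])
    rw [this]; exact hl0 _
  · have e : Set.uIcc 0 z.im = Set.Icc 0 z.im := Set.uIcc_of_le hz.le
    simp only [strip, e] at hlc hw
    rw [min_eq_left hz.le, max_eq_right hz.le] at hld
    exact eqOn_zero_of_scalar hz hlc hld hl0 hw

/-! ### The norm analytic continuation on a Banach space -/

/-- `f` continues the orbit `t ↦ α_t(a)` to the strip `S(z)`. -/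
structure IsContinuation {E : Type*} [NormedAddCommGroup E] [NormedSpace ℂ E]
    (α : OneParamRep E) (z : ℂ) (a : E) (f : ℂ → E) : Prop where
  continuousOn : ContinuousOn f (strip z)
  analyticOn : AnalyticOnNhd ℂ f (interior (strip z))
  eq_real : ∀ t : ℝ, α t a = f t

/-- The graph of `α_z`: the pairs `(a, f z)` where `f` continues the orbit of `a` to `S(z)`. -/
def analyticGraph {E : Type*} [NormedAddCommGroup E] [NormedSpace ℂ E]
    (α : OneParamRep E) (z : ℂ) : Submodule ℂ (E × E) where
  carrier := {p | ∃ f : ℂ → E, IsContinuation α z p.1 f ∧ f z = p.2}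
  zero_mem' := ⟨0, ⟨continuousOn_const, analyticOnNhd_const, by simp⟩, rfl⟩
  add_mem' := by
    rintro _ _ ⟨f, hf, hfz⟩ ⟨g, hg, hgz⟩
    exact ⟨f + g, ⟨hf.continuousOn.add hg.continuousOn, hf.analyticOn.add hg.analyticOn,
      fun t => by simp [hf.eq_real, hg.eq_real]⟩, by simp [hfz, hgz]⟩
  smul_mem' := by
    rintro c _ ⟨f, hf, hfz⟩
    exact ⟨c • f, ⟨hf.continuousOn.const_smul c, fun w hw => (hf.analyticOn w hw).const_smul,
      fun t => by simp [hf.eq_real]⟩, by simp [hfz]⟩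

/-- The analytic continuation `α_z`, an operator in `E`. -/
noncomputable def analyticCont {E : Type*} [NormedAddCommGroup E] [NormedSpace ℂ E]
    (α : OneParamRep E) (z : ℂ) : E →ₗ.[ℂ] E :=
  (analyticGraph α z).toLinearPMap

/-- `α_z` is well defined: its graph is the set of pairs by which it was defined. -/
theorem analyticCont_graph {E : Type*} [NormedAddCommGroup E] [NormedSpace ℂ E]
    (α : OneParamRep E) (z : ℂ) : (analyticCont α z).graph = analyticGraph α z := by
  refine Submodule.toLinearPMap_graph_eq _ ?_
  rintro ⟨a, b⟩ ⟨f, hf, hfz⟩ ha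
  simp only at ha hf hfz
  subst ha
  rw [← hfz]
  exact eqOn_zero_strip hf.continuousOn hf.analyticOn (fun t => by simp [← hf.eq_real])
    (self_mem_strip z)

/-! ### The strict topology on the multiplier algebra -/

/-- The multiplier algebra `M(A)`, as a type synonym that carries the strict topology instead of
the norm topology. -/
def StrictMultiplier (A : Type*) [NonUnitalCStarAlgebra A] : Type _ := 𝓜(ℂ, A)

noncomputable instance (A : Type*) [NonUnitalCStarAlgebra A] : AddCommGroup (StrictMultiplier A) :=
  inferInstanceAs (AddCommGroup 𝓜(ℂ, A))

noncomputable instance (A : Type*) [NonUnitalCStarAlgebra A] : Module ℂ (StrictMultiplier A) :=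
  inferInstanceAs (Module ℂ 𝓜(ℂ, A))

/-- The identity map from `M(A)` to its type synonym. -/
noncomputable def toStrict (A : Type*) [NonUnitalCStarAlgebra A] :
    𝓜(ℂ, A) ≃ₗ[ℂ] StrictMultiplier A :=
  LinearEquiv.refl ℂ 𝓜(ℂ, A)

/-- A multiplier `m` seen as the pair of maps `b ↦ m b` and `b ↦ b m` on `A`. -/
noncomputable def actions (A : Type*) [NonUnitalCStarAlgebra A] :
    StrictMultiplier A →ₗ[ℂ] (A → A) × (A → A) where
  toFun m := (fun b => ((toStrict A).symm m).fst b, fun b => ((toStrict A).symm m).snd b)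
  map_add' m n := by simp only [map_add]; rfl
  map_smul' c m := by simp only [map_smul]; rfl

/-- The strict topology: the coarsest topology for which all the maps `m ↦ m b` and `m ↦ b m`,
`b ∈ A`, into `A` with its norm topology, are continuous. -/
noncomputable instance (A : Type*) [NonUnitalCStarAlgebra A] : TopologicalSpace (StrictMultiplier A) :=
  TopologicalSpace.induced (actions A) inferInstance

instance (A : Type*) [NonUnitalCStarAlgebra A] : ContinuousAdd (StrictMultiplier A) :=
  continuousAdd_induced (actions A)

instance (A : Type*) [NonUnitalCStarAlgebra A] : ContinuousSMul ℂ (StrictMultiplier A) :=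
  continuousSMul_induced (actions A)

theorem tendsto_strict_iff {A : Type*} [NonUnitalCStarAlgebra A] {ι : Type*} {l : Filter ι}
    {f : ι → 𝓜(ℂ, A)} {m : 𝓜(ℂ, A)} :
    Filter.Tendsto (fun i => toStrict A (f i)) l (𝓝 (toStrict A m)) ↔
      (∀ b, Filter.Tendsto (fun i => (f i).fst b) l (𝓝 (m.fst b))) ∧
      (∀ b, Filter.Tendsto (fun i => (f i).snd b) l (𝓝 (m.snd b))) := by
  rw [nhds_induced, Filter.tendsto_comap_iff, Prod.tendsto_iff, tendsto_pi_nhds, tendsto_pi_nhds]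
  rfl

/-- The embedding of `A` into `M(A)`. -/
noncomputable def embed (A : Type*) [NonUnitalCStarAlgebra A] : A →ₗ[ℂ] StrictMultiplier A :=
  (toStrict A).toLinearMap ∘ₗ
    ((DoubleCentralizer.coeHom : A →⋆ₙₐ[ℂ] 𝓜(ℂ, A)) : A →ₗ[ℂ] 𝓜(ℂ, A))

theorem embed_apply {A : Type*} [NonUnitalCStarAlgebra A] (a : A) :
    embed A a = toStrict A (a : 𝓜(ℂ, A)) := rfl

theorem eq_zero_of_forall_mul {A : Type*} [NonUnitalCStarAlgebra A] {a : A}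
    (h : ∀ c : A, c * a = 0) : a = 0 :=
  CStarRing.star_mul_self_eq_zero_iff a |>.1 (h _)

theorem embed_injective (A : Type*) [NonUnitalCStarAlgebra A] :
    Function.Injective (embed A) := by
  refine (injective_iff_map_eq_zero _).2 fun a ha => eq_zero_of_forall_mul fun c => ?_
  rw [embed_apply, LinearEquiv.map_eq_zero_iff] at ha
  have : (a : 𝓜(ℂ, A)).snd c = 0 := by rw [ha]; simp
  simpa using this

/-- An operator in `A` seen as an operator in `M(A)`, with the same domain and values. -/
noncomputable def embedOperator {A : Type*} [NonUnitalCStarAlgebra A] (T : A →ₗ.[ℂ] A) :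
    StrictMultiplier A →ₗ.[ℂ] StrictMultiplier A :=
  (T.graph.map ((embed A).prodMap (embed A))).toLinearPMap

theorem embedOperator_graph {A : Type*} [NonUnitalCStarAlgebra A] (T : A →ₗ.[ℂ] A) :
    (embedOperator T).graph = T.graph.map ((embed A).prodMap (embed A)) := by
  refine Submodule.toLinearPMap_graph_eq _ ?_
  rintro _ ⟨⟨a, b⟩, hab, rfl⟩ h
  simp only [LinearMap.prodMap_apply] at h ⊢
  have ha : a = 0 := embed_injective A (by simpa using h)
  rw [T.graph_fst_eq_zero_snd hab ha, map_zero]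

/-! ### Strict extension of linear maps to the multiplier algebra -/

/-- `θ` is a linear map on `M(A)` that extends `ρ` and is strictly continuous on norm bounded
subsets of `M(A)`. -/
structure IsStrictExtension {A : Type*} [NonUnitalCStarAlgebra A] (ρ : A →L[ℂ] A)
    (θ : 𝓜(ℂ, A) →ₗ[ℂ] 𝓜(ℂ, A)) : Prop where
  extends_coe : ∀ a : A, θ (a : 𝓜(ℂ, A)) = ((ρ a : A) : 𝓜(ℂ, A))
  continuousOn_bounded : ∀ S : Set 𝓜(ℂ, A), Bornology.IsBounded S →
    ContinuousOn (fun m => toStrict A (θ ((toStrict A).symm m))) (toStrict A '' S)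

theorem fst_mul {A : Type*} [NonUnitalCStarAlgebra A] (m : 𝓜(ℂ, A)) (x y : A) :
    m.fst (x * y) = m.fst x * y := by
  rw [← sub_eq_zero]
  refine eq_zero_of_forall_mul fun c => ?_
  rw [mul_sub, ← m.central, ← mul_assoc c, ← m.central, mul_assoc, sub_self]

theorem multiplier_ext {A : Type*} [NonUnitalCStarAlgebra A] {m n : 𝓜(ℂ, A)}
    (h₁ : ∀ b, m.fst b = n.fst b) (h₂ : ∀ b, m.snd b = n.snd b) : m = n :=
  DoubleCentralizer.ext _ _ _ _
    (Prod.ext (ContinuousLinearMap.ext h₁) (ContinuousLinearMap.ext h₂))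

theorem IsStrictExtension.unique {A : Type*} [NonUnitalCStarAlgebra A] {ρ : A →L[ℂ] A}
    {θ θ' : 𝓜(ℂ, A) →ₗ[ℂ] 𝓜(ℂ, A)} (h : IsStrictExtension ρ θ) (h' : IsStrictExtension ρ θ') :
    θ = θ' := by
  let _ := CStarAlgebra.spectralOrder A
  let _ := CStarAlgebra.spectralOrderedRing A
  have hu := CStarAlgebra.increasingApproximateUnit A
  have := hu.neBot
  ext1 m
  set l := CStarAlgebra.approximateUnit A
  have hm : Filter.Tendsto (fun e => toStrict A ((m.fst e : A) : 𝓜(ℂ, A))) l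
      (𝓝 (toStrict A m)) := by
    rw [tendsto_strict_iff]
    refine ⟨fun b => ?_, fun b => ?_⟩
    · simp only [DoubleCentralizer.coe_fst, ContinuousLinearMap.mul_apply', ← fst_mul]
      exact (m.fst.continuous.tendsto b).comp (hu.tendsto_mul_right b)
    · simp only [DoubleCentralizer.coe_snd, ContinuousLinearMap.flip_apply,
        ContinuousLinearMap.mul_apply', ← m.central]
      exact hu.tendsto_mul_left _
  have hS : ∀ᶠ e in l, ((m.fst e : A) : 𝓜(ℂ, A)) ∈ Metric.closedBall (0 : 𝓜(ℂ, A)) ‖m‖ := by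
    filter_upwards [hu.eventually_norm] with e he
    rw [mem_closedBall_zero_iff, ← DoubleCentralizer.norm_fst, DoubleCentralizer.coe_fst]
    refine (ContinuousLinearMap.opNorm_mul_apply_le ℂ A _).trans ?_
    refine (m.fst.le_opNorm e).trans ?_
    rw [DoubleCentralizer.norm_fst]
    exact mul_le_of_le_one_right (norm_nonneg _) he
  have lim : ∀ {η : 𝓜(ℂ, A) →ₗ[ℂ] 𝓜(ℂ, A)}, IsStrictExtension ρ η →
      Filter.Tendsto (fun e => toStrict A ((ρ (m.fst e) : A) : 𝓜(ℂ, A))) l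
        (𝓝 (toStrict A (η m))) := by
    intro η hη
    have hc := hη.continuousOn_bounded _ (Metric.isBounded_closedBall (x := 0) (r := ‖m‖))
      (toStrict A m) ⟨m, by simp, rfl⟩
    have := hc.tendsto.comp (tendsto_nhdsWithin_iff.2
      ⟨hm, hS.mono fun e he => Set.mem_image_of_mem _ he⟩)
    simpa [Function.comp_def, hη.extends_coe] using this
  have h1 := tendsto_strict_iff.1 (lim h)
  have h2 := tendsto_strict_iff.1 (lim h')
  exact multiplier_ext (fun b => tendsto_nhds_unique (h1.1 b) (h2.1 b))
    (fun b => tendsto_nhds_unique (h1.2 b) (h2.2 b))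

/-- The maps of a semi-multiplicative representation have unique strict extensions. -/
theorem OneParamRep.SemiMultiplicative.existsUnique_strictExtension {A : Type*}
    [NonUnitalCStarAlgebra A] {α : OneParamRep A} (hα : α.SemiMultiplicative) (t : ℝ) :
    ∃! θ : 𝓜(ℂ, A) →ₗ[ℂ] 𝓜(ℂ, A), IsStrictExtension (α t) θ := by
  obtain ⟨β, γ, -, -, hm⟩ := hα
  refine existsUnique_of_exists_of_unique ?_ fun _ _ h h' => h.unique h'
  refine ⟨{ toFun := fun m =>
              { fst := (α t).comp (m.fst.comp (γ (-t)))
                snd := (α t).comp (m.snd.comp (β (-t)))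
                central := ?_ }
            map_add' := ?_
            map_smul' := ?_ }, ?_, ?_⟩
  · intro x y
    simp only [ContinuousLinearMap.comp_apply]
    nth_rw 2 [← β.apply_neg_apply t x]
    nth_rw 1 [← γ.apply_neg_apply t y]
    rw [(hm t _ _).1, (hm t _ _).2, m.central]
  · intro m n
    exact multiplier_ext (fun b => by simp) (fun b => by simp)
  · intro c m
    exact multiplier_ext (fun b => by simp) (fun b => by simp)
  · intro a
    refine multiplier_ext (fun b => ?_) (fun b => ?_)
    · simp [← (hm t _ _).2, γ.apply_neg_apply]
    · simp [← (hm t _ _).1, β.apply_neg_apply]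
  · intro S _
    refine Continuous.continuousOn (continuous_iff_continuousAt.2 fun m => ?_)
    have hid : Filter.Tendsto (fun n => toStrict A ((toStrict A).symm n)) (𝓝 m)
        (𝓝 (toStrict A ((toStrict A).symm m))) := by
      simp only [LinearEquiv.apply_symm_apply]
      exact Filter.tendsto_id
    rw [tendsto_strict_iff] at hid
    refine tendsto_strict_iff.2 ⟨fun b => ?_, fun b => ?_⟩
    · exact ((α t).continuous.tendsto _).comp (hid.1 _)
    · exact ((α t).continuous.tendsto _).comp (hid.2 _)

/-- The map on `M(A)` obtained from `α_t`: the unique strict extension of `α_t`. -/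
noncomputable def strictExt {A : Type*} [NonUnitalCStarAlgebra A] {α : OneParamRep A}
    (hα : α.SemiMultiplicative) (t : ℝ) : 𝓜(ℂ, A) →ₗ[ℂ] 𝓜(ℂ, A) :=
  (hα.existsUnique_strictExtension t).choose

theorem isStrictExtension_strictExt {A : Type*} [NonUnitalCStarAlgebra A] {α : OneParamRep A}
    (hα : α.SemiMultiplicative) (t : ℝ) : IsStrictExtension (α t) (strictExt hα t) :=
  (hα.existsUnique_strictExtension t).choose_spec.1

/-! ### The strict analytic continuation on the multiplier algebra -/

/-- `f` is a strictly continuous, norm analytic continuation of the orbit `t ↦ α_t(a)`,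
`a ∈ M(A)`, to the strip `S(z)`. -/
structure IsStrictContinuation {A : Type*} [NonUnitalCStarAlgebra A] {α : OneParamRep A}
    (hα : α.SemiMultiplicative) (z : ℂ) (a : 𝓜(ℂ, A)) (f : ℂ → 𝓜(ℂ, A)) : Prop where
  continuousOn : ContinuousOn (fun y => toStrict A (f y)) (strip z)
  analyticOn : AnalyticOnNhd ℂ f (interior (strip z))
  eq_real : ∀ t : ℝ, strictExt hα t a = f t

/-- The graph of the strict analytic continuation at `z`. -/
def strictGraph {A : Type*} [NonUnitalCStarAlgebra A] {α : OneParamRep A}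
    (hα : α.SemiMultiplicative) (z : ℂ) : Submodule ℂ (StrictMultiplier A × StrictMultiplier A) where
  carrier := {p | ∃ f : ℂ → 𝓜(ℂ, A),
    IsStrictContinuation hα z ((toStrict A).symm p.1) f ∧ toStrict A (f z) = p.2}
  zero_mem' := ⟨0, ⟨continuousOn_const, analyticOnNhd_const, by simp⟩, by simp⟩
  add_mem' := by
    rintro _ _ ⟨f, hf, hfz⟩ ⟨g, hg, hgz⟩
    refine ⟨f + g, ⟨?_, hf.analyticOn.add hg.analyticOn,
      fun t => by simp [hf.eq_real, hg.eq_real]⟩, by simp [hfz, hgz]⟩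
    simp only [Pi.add_apply, map_add]
    exact hf.continuousOn.add hg.continuousOn
  smul_mem' := by
    rintro c _ ⟨f, hf, hfz⟩
    refine ⟨c • f, ⟨?_, fun w hw => (hf.analyticOn w hw).const_smul,
      fun t => by simp [hf.eq_real]⟩, by simp [hfz]⟩
    simp only [Pi.smul_apply, map_smul]
    exact (continuousOn_const (c := c)).smul hf.continuousOn

/-- The strict analytic continuation at `z`, an operator in `M(A)`. -/
noncomputable def strictCont {A : Type*} [NonUnitalCStarAlgebra A] {α : OneParamRep A}
    (hα : α.SemiMultiplicative) (z : ℂ) : StrictMultiplier A →ₗ.[ℂ] StrictMultiplier A :=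
  (strictGraph hα z).toLinearPMap

/-- The strict analytic continuation is well defined. -/
theorem strictCont_graph {A : Type*} [NonUnitalCStarAlgebra A] {α : OneParamRep A}
    (hα : α.SemiMultiplicative) (z : ℂ) : (strictCont hα z).graph = strictGraph hα z := by
  refine Submodule.toLinearPMap_graph_eq _ ?_
  rintro ⟨a, b⟩ ⟨f, hf, hfz⟩ ha
  simp only at ha hf hfz
  subst ha
  rw [← hfz, LinearEquiv.map_eq_zero_iff]
  have h0 : ∀ t : ℝ, f t = 0 := fun t => by simp [← hf.eq_real]
  have hc := fun w hw => tendsto_strict_iff.1 (hf.continuousOn w hw)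
  have ev₁ : ∀ c : A, ∃ L : 𝓜(ℂ, A) →L[ℂ] A, ∀ m, L m = m.fst c := fun c =>
    ⟨LinearMap.mkContinuous
      { toFun := fun m => m.fst c, map_add' := fun _ _ => rfl, map_smul' := fun _ _ => rfl } ‖c‖
      (fun m => by
        rw [mul_comm, ← DoubleCentralizer.norm_fst]
        exact m.fst.le_opNorm c), fun m => rfl⟩
  have ev₂ : ∀ c : A, ∃ L : 𝓜(ℂ, A) →L[ℂ] A, ∀ m, L m = m.snd c := fun c =>
    ⟨LinearMap.mkContinuous
      { toFun := fun m => m.snd c, map_add' := fun _ _ => rfl, map_smul' := fun _ _ => rfl } ‖c‖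
      (fun m => by
        rw [mul_comm, ← DoubleCentralizer.norm_snd]
        exact m.snd.le_opNorm c), fun m => rfl⟩
  refine multiplier_ext (fun c => ?_) (fun c => ?_)
  · obtain ⟨L, hL⟩ := ev₁ c
    have := eqOn_zero_strip (f := fun w => L (f w)) (z := z)
      (fun w hw => by simp only [hL]; exact (hc w hw).1 c)
      (fun w hw => (L.analyticAt _).comp (hf.analyticOn w hw)) (fun t => by simp [h0])
      (self_mem_strip z)
    simpa [hL] using this
  · obtain ⟨L, hL⟩ := ev₂ c
    have := eqOn_zero_strip (f := fun w => L (f w)) (z := z)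
      (fun w hw => by simp only [hL]; exact (hc w hw).2 c)
      (fun w hw => (L.analyticAt _).comp (hf.analyticOn w hw)) (fun t => by simp [h0])
      (self_mem_strip z)
    simpa [hL] using this

end StrictContinuation

namespace StrictContinuation

/-!
Let `β`, `γ` be the representations with `β_t(b) α_t(a) = α_t(ba)` and `α_t(a) γ_t(b) = α_t(ab)`.
A pair `(m, n)` of multipliers lies in the graph of the strict continuation of `α` at `z` exactly
when left multiplication by `m` and `n` intertwines `γ_z` with `α_z`, and right multiplication
intertwines `β_z` with `α_z`. This condition is strictly closed because `α_z` is norm closed.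
For the core, let `e` run through an approximate unit and smear it with Gaussian weights along `γ`
to an element `e'` that is entire for `γ`: then `m e'` lies in `D(α_z)`, and `m e'` and
`α_z(m e') = n γ_z(e')` converge strictly to `m` and `n`.
-/

open Filter

/-! ### Bounded holomorphic functions on a strip -/

theorem add_ofReal_mem_strip {z y : ℂ} (hy : y ∈ strip z) (t : ℝ) : y + t ∈ strip z := by
  simpa [strip] using hy

theorem self_add_ofReal_mem_strip (z : ℂ) (t : ℝ) : z + t ∈ strip z :=
  add_ofReal_mem_strip (self_mem_strip z) t

/-- The functions on the strip `S(z)` to which the maximum principle applies: continuous and bounded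
on `S(z)`, analytic on its interior. -/
structure IsStripHolomorphic {E : Type*} [NormedAddCommGroup E] [NormedSpace ℂ E] (z : ℂ)
    (h : ℂ → E) : Prop where
  continuousOn : ContinuousOn h (strip z)
  analyticOn : AnalyticOnNhd ℂ h (interior (strip z))
  bounded : ∃ C, ∀ y ∈ strip z, ‖h y‖ ≤ C

namespace IsStripHolomorphic

variable {E : Type*} [NormedAddCommGroup E] [NormedSpace ℂ E] {z : ℂ} {g h : ℂ → E}

theorem add (hg : IsStripHolomorphic z g) (hh : IsStripHolomorphic z h) :
    IsStripHolomorphic z (fun y => g y + h y) := by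
  obtain ⟨C, hC⟩ := hg.bounded
  obtain ⟨D, hD⟩ := hh.bounded
  exact ⟨hg.continuousOn.add hh.continuousOn, hg.analyticOn.add hh.analyticOn, C + D,
    fun y hy => norm_add_le_of_le (hC y hy) (hD y hy)⟩

theorem const_smul (hg : IsStripHolomorphic z g) (c : ℂ) :
    IsStripHolomorphic z (fun y => c • g y) := by
  obtain ⟨C, hC⟩ := hg.bounded
  exact ⟨hg.continuousOn.const_smul c, fun w hw => (hg.analyticOn w hw).const_smul, ‖c‖ * C,
    fun y hy => (norm_smul_le c _).trans <| by gcongr; exact hC y hy⟩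

theorem sub (hg : IsStripHolomorphic z g) (hh : IsStripHolomorphic z h) :
    IsStripHolomorphic z (fun y => g y - h y) := by
  simpa only [sub_eq_add_neg, neg_one_smul] using hg.add (hh.const_smul (-1))

theorem eqOn (hg : IsStripHolomorphic z g) (hh : IsStripHolomorphic z h)
    (h₀ : ∀ t : ℝ, g t = h t) : Set.EqOn g h (strip z) := fun _ hy =>
  sub_eq_zero.1 <| eqOn_zero_strip (hg.sub hh).continuousOn (hg.sub hh).analyticOn
    (fun t => sub_eq_zero.2 (h₀ t)) hy

theorem norm_le (hh : IsStripHolomorphic z h) {C : ℝ} (h₀ : ∀ t : ℝ, ‖h t‖ ≤ C)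
    (h₁ : ∀ t : ℝ, ‖h (z + t)‖ ≤ C) {y : ℂ} (hy : y ∈ strip z) : ‖h y‖ ≤ C := by
  have on_real : ∀ w : ℂ, w.im = 0 → ‖h w‖ ≤ C := fun w hw => by
    rw [show w = (w.re : ℂ) from Complex.ext (by simp) (by simp [hw])]
    exact h₀ _
  have on_line : ∀ w : ℂ, w.im = z.im → ‖h w‖ ≤ C := fun w hw => by
    rw [show w = z + ((w.re - z.re : ℝ) : ℂ) from Complex.ext (by simp) (by simp [hw])]
    exact h₁ _
  by_cases hz : z.im = 0
  · exact on_real y (by simpa [strip, hz] using hy)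
  have hlt : min 0 z.im < max 0 z.im := min_lt_max.2 (Ne.symm hz)
  refine PhragmenLindelof.horizontal_strip (a := min 0 z.im) (b := max 0 z.im) ⟨?_, ?_⟩ ?_ ?_ ?_
    hy.1 hy.2
  · exact (interior_strip z ▸ hh.analyticOn).differentiableOn
  · rw [Complex.closure_preimage_im, closure_Ioo hlt.ne]
    exact hh.continuousOn
  · obtain ⟨D, hD⟩ := hh.bounded
    refine ⟨0, div_pos Real.pi_pos (sub_pos.2 hlt), 0, Asymptotics.IsBigO.of_bound D ?_⟩
    filter_upwards [mem_inf_of_right (mem_principal_self _)] with w hw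
    simpa using hD w ⟨hw.1.le, hw.2.le⟩
  · intro w hw
    rcases min_choice 0 z.im with e | e
    exacts [on_real w (hw.trans e), on_line w (hw.trans e)]
  · intro w hw
    rcases max_choice 0 z.im with e | e
    exacts [on_real w (hw.trans e), on_line w (hw.trans e)]

theorem of_tendstoUniformlyOn {h : ℕ → ℂ → E} [CompleteSpace E]
    (hh : ∀ n, IsStripHolomorphic z (h n)) (hg : TendstoUniformlyOn h g atTop (strip z)) :
    IsStripHolomorphic z g where
  continuousOn := hg.continuousOn (Frequently.of_forall fun n => (hh n).continuousOn)
  analyticOn := by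
    rw [Complex.analyticOnNhd_iff_differentiableOn isOpen_interior]
    exact (hg.mono interior_subset).tendstoLocallyUniformlyOn.differentiableOn
      (.of_forall fun n => (hh n).analyticOn.differentiableOn) isOpen_interior
  bounded := by
    obtain ⟨n, hn⟩ := (Metric.tendstoUniformlyOn_iff.1 hg 1 one_pos).exists
    obtain ⟨D, hD⟩ := (hh n).bounded
    refine ⟨1 + D, fun y hy => ?_⟩
    rw [← sub_add_cancel (g y) (h n y)]
    exact norm_add_le_of_le (dist_eq_norm (g y) (h n y) ▸ (hn y hy).le) (hD y hy)

end IsStripHolomorphic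

/-! ### Operator-valued analytic functions -/

section OperatorValued

variable {V E : Type*} [NormedAddCommGroup V] [NormedSpace ℂ V]
  [NormedAddCommGroup E] [NormedSpace ℂ E] {Φ : ℂ → V →L[ℂ] E} {U : Set ℂ}

theorem continuousOn_of_differentiableOn_apply (hU : IsOpen U) {C : ℝ}
    (hC : ∀ y ∈ U, ‖Φ y‖ ≤ C) (hΦ : ∀ v, DifferentiableOn ℂ (fun y => Φ y v) U) :
    ContinuousOn Φ U := by
  intro c hc
  obtain ⟨r, hr, hrU⟩ := Metric.isOpen_iff.1 hU c hc
  have hC0 : 0 ≤ C := (norm_nonneg _).trans (hC c hc)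
  -- the Schwarz lemma, uniformly over the unit ball of `V`
  have lipschitz : ∀ y ∈ Metric.ball c r, ‖Φ y - Φ c‖ ≤ 2 * C / r * dist y c := by
    intro y hy
    refine ContinuousLinearMap.opNorm_le_bound _ (by positivity) fun v => ?_
    have maps_to : Set.MapsTo (fun w => Φ w v) (Metric.ball c r)
        (Metric.closedBall (Φ c v) (2 * C * ‖v‖)) := by
      intro w hw
      rw [Metric.mem_closedBall, dist_eq_norm, ← sub_apply]
      refine ContinuousLinearMap.le_of_opNorm_le _ ?_ v
      rw [two_mul]
      exact norm_sub_le_of_le (hC w (hrU hw)) (hC c hc)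
    rw [sub_apply, ← dist_eq_norm, mul_right_comm, ← mul_div_right_comm]
    exact Complex.dist_le_div_mul_dist_of_mapsTo_ball ((hΦ v).mono hrU) maps_to hy
  refine ContinuousAt.continuousWithinAt ?_
  rw [ContinuousAt, tendsto_iff_norm_sub_tendsto_zero]
  refine squeeze_zero' (.of_forall fun _ => norm_nonneg _)
    (eventually_of_mem (Metric.ball_mem_nhds c hr) lipschitz) ?_
  simpa using ((continuous_id.dist (continuous_const (y := c))).const_mul (2 * C / r)).tendsto c

theorem analyticOnNhd_of_continuousOn_of_differentiableOn_apply [CompleteSpace E] (hU : IsOpen U)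
    (hcont : ContinuousOn Φ U) (hΦ : ∀ v, DifferentiableOn ℂ (fun y => Φ y v) U) :
    AnalyticOnNhd ℂ Φ U := by
  intro c hc
  obtain ⟨r, hr, hrU⟩ := Metric.nhds_basis_closedBall.mem_iff.1 (hU.mem_nhds hc)
  lift r to NNReal using hr.le
  have hsphere : ContinuousOn Φ (Metric.sphere c r) :=
    hcont.mono (Metric.sphere_subset_closedBall.trans hrU)
  refine (hasFPowerSeriesOn_cauchy_integral (hsphere.circleIntegrable hr.le)
    hr).analyticAt.congr ?_
  filter_upwards [Metric.ball_mem_nhds c hr] with w hw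
  have hne : ∀ ζ ∈ Metric.sphere c (r : ℝ), ζ - w ≠ 0 := fun ζ hζ h0 =>
    (Metric.mem_ball.1 hw).ne (sub_eq_zero.1 h0 ▸ hζ)
  have hint : CircleIntegrable (fun ζ => (ζ - w)⁻¹ • Φ ζ) c r :=
    ((ContinuousOn.inv₀ (by fun_prop) hne).smul hsphere).circleIntegrable hr.le
  ext v
  have hv : DiffContOnCl ℂ (fun y => Φ y v) (Metric.ball c r) :=
    ((hΦ v).mono hrU).diffContOnCl_ball subset_rfl
  rw [← hv.two_pi_i_inv_smul_circleIntegral_sub_inv_smul hw, smul_apply]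
  congr 1
  simp only [circleIntegral]
  rw [ContinuousLinearMap.intervalIntegral_apply hint.out]
  simp only [smul_apply]

theorem analyticOnNhd_of_differentiableOn_apply [CompleteSpace E] (hU : IsOpen U) {C : ℝ}
    (hC : ∀ y ∈ U, ‖Φ y‖ ≤ C) (hΦ : ∀ v, DifferentiableOn ℂ (fun y => Φ y v) U) :
    AnalyticOnNhd ℂ Φ U :=
  analyticOnNhd_of_continuousOn_of_differentiableOn_apply hU
    (continuousOn_of_differentiableOn_apply hU hC hΦ) hΦ

end OperatorValued

theorem differentiableAt_of_linearIsometry_comp {V W : Type*} [NormedAddCommGroup V]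
    [NormedSpace ℂ V] [CompleteSpace V] [NormedAddCommGroup W] [NormedSpace ℂ W] (ι : V →ₗᵢ[ℂ] W)
    {f : ℂ → V} {y : ℂ} (hf : DifferentiableAt ℂ (fun w => ι (f w)) y) :
    DifferentiableAt ℂ f y := by
  have hι := ι.isometry.isClosedEmbedding
  have hslope := hasDerivAt_iff_tendsto_slope.1 hf.hasDerivAt
  rw [show slope (fun w => ι (f w)) y = fun w => ι (slope f y w) by
    ext w; simp [slope_def_module]] at hslope
  obtain ⟨v, hv⟩ : deriv (fun w => ι (f w)) y ∈ Set.range ι :=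
    hι.isClosed_range.mem_of_tendsto hslope (.of_forall fun w => ⟨_, rfl⟩)
  rw [← hv] at hslope
  exact (hasDerivAt_iff_tendsto_slope.2
    (hι.isInducing.tendsto_nhds_iff.2 hslope)).differentiableAt

theorem tendsto_apply_of_eventually_norm_le {ι V E : Type*} [NormedAddCommGroup V]
    [NormedSpace ℂ V] [NormedAddCommGroup E] [NormedSpace ℂ E] {l : Filter ι} {Φ : ι → V →L[ℂ] E}
    {P : ι → V} {p : V} {q : E} {C : ℝ} (hC : ∀ᶠ y in l, ‖Φ y‖ ≤ C)
    (hΦ : Tendsto (fun y => Φ y p) l (𝓝 q)) (hP : Tendsto P l (𝓝 p)) :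
    Tendsto (fun y => Φ y (P y)) l (𝓝 q) := by
  have h : Tendsto (fun y => Φ y (P y - p)) l (𝓝 0) := by
    refine squeeze_zero_norm' (a := fun y => C * ‖P y - p‖) ?_ ?_
    · filter_upwards [hC] with y hy using (Φ y).le_of_opNorm_le hy _
    · simpa only [mul_zero] using (tendsto_iff_norm_sub_tendsto_zero.1 hP).const_mul C
  simpa only [map_sub, sub_add_cancel, zero_add] using h.add hΦ

/-- The operator-valued functions on the strip `S(z)` that are strongly continuous on `S(z)` and
norm analytic on its interior. -/
structure IsStrongStripHolomorphic {V E : Type*} [NormedAddCommGroup V] [NormedSpace ℂ V]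
    [NormedAddCommGroup E] [NormedSpace ℂ E] (z : ℂ) (Φ : ℂ → V →L[ℂ] E) : Prop where
  continuousOn_apply : ∀ x, ContinuousOn (fun y => Φ y x) (strip z)
  analyticOn : AnalyticOnNhd ℂ Φ (interior (strip z))

namespace IsStrongStripHolomorphic

variable {V E : Type*} [NormedAddCommGroup V] [NormedSpace ℂ V]
  [NormedAddCommGroup E] [NormedSpace ℂ E] {z : ℂ} {Φ : ℂ → V →L[ℂ] E} {P : ℂ → V}

theorem eventually_norm_le [CompleteSpace V] (hΦ : IsStrongStripHolomorphic z Φ) {y : ℂ} :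
    ∃ C, ∀ᶠ w in 𝓝[strip z] y, ‖Φ w‖ ≤ C := by
  set K := strip z ∩ Metric.closedBall y 1
  have hK : IsCompact K :=
    (isCompact_closedBall y 1).inter_left (isClosed_Icc.preimage Complex.continuous_im)
  have pointwise : ∀ x, ∃ C, ∀ w : K, ‖Φ w x‖ ≤ C := fun x => by
    obtain ⟨C, hC⟩ := hK.exists_bound_of_continuousOn
      ((hΦ.continuousOn_apply x).mono Set.inter_subset_left)
    exact ⟨C, fun w => hC w w.2⟩
  obtain ⟨C, hC⟩ := banach_steinhaus pointwise
  refine ⟨C, ?_⟩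
  filter_upwards [inter_mem_nhdsWithin _ (Metric.closedBall_mem_nhds y one_pos)] with w hw
  exact hC ⟨w, hw⟩

theorem continuousOn_clm_apply [CompleteSpace V] (hΦ : IsStrongStripHolomorphic z Φ)
    (hP : ContinuousOn P (strip z)) : ContinuousOn (fun y => Φ y (P y)) (strip z) := by
  intro y hy
  obtain ⟨C, hC⟩ := hΦ.eventually_norm_le (y := y)
  exact tendsto_apply_of_eventually_norm_le hC (hΦ.continuousOn_apply (P y) y hy) (hP y hy)

theorem analyticOn_clm_apply [CompleteSpace E] (hΦ : IsStrongStripHolomorphic z Φ)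
    (hP : DifferentiableOn ℂ P (interior (strip z))) :
    AnalyticOnNhd ℂ (fun y => Φ y (P y)) (interior (strip z)) := by
  rw [Complex.analyticOnNhd_iff_differentiableOn isOpen_interior]
  exact hΦ.analyticOn.differentiableOn.clm_apply hP

end IsStrongStripHolomorphic

/-! ### Strip holomorphic functions with prescribed boundary values -/

section Boundary

variable {V E : Type*} [NormedAddCommGroup V] [NormedSpace ℂ V]
  [NormedAddCommGroup E] [NormedSpace ℂ E] {z : ℂ} {u v : ℝ → V →L[ℂ] E} {K : ℝ}

/-- The vectors `x` for which `t ↦ u_t(x)` and `t ↦ v_t(x)` are the boundary values on `ℝ` and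
`z + ℝ` of a bounded holomorphic function on the strip. Both the graph of `α_z` and the vectors on
which an orbit `t ↦ α_t T γ_{-t}` of operators continues to the strip are of this form. -/
def boundarySubmodule (z : ℂ) (u v : ℝ → V →L[ℂ] E) : Submodule ℂ V where
  carrier := {x | ∃ h : ℂ → E, IsStripHolomorphic z h ∧ (∀ t : ℝ, h t = u t x) ∧
    ∀ t : ℝ, h (z + t) = v t x}
  zero_mem' := ⟨fun _ => 0, ⟨continuousOn_const, analyticOnNhd_const, 0, by simp⟩, by simp, by simp⟩
  add_mem' := by
    rintro _ _ ⟨f, hf, hf₀, hf₁⟩ ⟨g, hg, hg₀, hg₁⟩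
    exact ⟨_, hf.add hg, fun t => by simp [hf₀, hg₀], fun t => by simp [hf₁, hg₁]⟩
  smul_mem' := by
    rintro c _ ⟨f, hf, hf₀, hf₁⟩
    exact ⟨_, hf.const_smul c, fun t => by simp [hf₀], fun t => by simp [hf₁]⟩

theorem IsStripHolomorphic.norm_le_of_boundary (hu : ∀ t, ‖u t‖ ≤ K) (hv : ∀ t, ‖v t‖ ≤ K)
    {h : ℂ → E} (hh : IsStripHolomorphic z h) {x : V} (h₀ : ∀ t : ℝ, h t = u t x)
    (h₁ : ∀ t : ℝ, h (z + t) = v t x) {y : ℂ} (hy : y ∈ strip z) : ‖h y‖ ≤ K * ‖x‖ :=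
  hh.norm_le (fun t => h₀ t ▸ (u t).le_of_opNorm_le (hu t) x)
    (fun t => h₁ t ▸ (v t).le_of_opNorm_le (hv t) x) hy

theorem isClosed_boundarySubmodule [CompleteSpace E] (hu : ∀ t, ‖u t‖ ≤ K)
    (hv : ∀ t, ‖v t‖ ≤ K) : IsClosed (boundarySubmodule z u v : Set V) := by
  refine IsSeqClosed.isClosed fun x a hx hxa => ?_
  choose h hh h₀ h₁ using hx
  have dist_le : ∀ m n, ∀ y ∈ strip z, dist (h m y) (h n y) ≤ K * dist (x m) (x n) := by
    intro m n y hy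
    rw [dist_eq_norm, dist_eq_norm]
    exact ((hh m).sub (hh n)).norm_le_of_boundary hu hv (fun t => by rw [h₀, h₀, map_sub])
      (fun t => by rw [h₁, h₁, map_sub]) hy
  have cauchy : UniformCauchySeqOn h atTop (strip z) := by
    rw [Metric.uniformCauchySeqOn_iff]
    intro ε hε
    have hK : 0 ≤ K := (norm_nonneg _).trans (hu 0)
    obtain ⟨N, hN⟩ := Metric.cauchySeq_iff.1 hxa.cauchySeq (ε / (K + 1)) (by positivity)
    refine ⟨N, fun m hm n hn y hy => (dist_le m n y hy).trans_lt ?_⟩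
    have := (lt_div_iff₀ (by positivity)).1 (hN m hm n hn)
    nlinarith [dist_nonneg (x := x m) (y := x n)]
  have lim : ∀ y ∈ strip z, Tendsto (fun n => h n y) atTop (𝓝 (limUnder atTop fun n => h n y)) :=
    fun y hy => (cauchy.cauchySeq hy).tendsto_limUnder
  refine ⟨fun y => limUnder atTop fun n => h n y,
    .of_tendstoUniformlyOn hh (cauchy.tendstoUniformlyOn_of_tendsto lim), fun t => ?_, fun t => ?_⟩
  · refine tendsto_nhds_unique (lim _ (ofReal_mem_strip z t)) ?_
    simpa only [h₀, Function.comp_def] using ((u t).continuous.tendsto a).comp hxa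
  · refine tendsto_nhds_unique (lim _ (self_add_ofReal_mem_strip z t)) ?_
    simpa only [h₁, Function.comp_def] using ((v t).continuous.tendsto a).comp hxa

theorem exists_boundary_evaluation [CompleteSpace E] (hu : ∀ t, ‖u t‖ ≤ K)
    (hv : ∀ t, ‖v t‖ ≤ K) :
    ∃ Φ : ℂ → boundarySubmodule z u v →L[ℂ] E, IsStrongStripHolomorphic z Φ ∧
      (∀ y ∈ strip z, ‖Φ y‖ ≤ K) ∧ (∀ (t : ℝ) (x), Φ t x = u t x) ∧
      ∀ (t : ℝ) (x), Φ (z + t) x = v t x := by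
  choose h hh h₀ h₁ using fun x : boundarySubmodule z u v => x.2
  have evaluation : ∀ y, ∃ T : boundarySubmodule z u v →L[ℂ] E,
      y ∈ strip z → ‖T‖ ≤ K ∧ ∀ x, T x = h x y := by
    intro y
    by_cases hy : y ∈ strip z
    · refine ⟨LinearMap.mkContinuous
        { toFun := fun x => h x y
          map_add' := fun x x' => (hh _).eqOn ((hh x).add (hh x')) (fun t => by simp [h₀]) hy
          map_smul' := fun c x => (hh _).eqOn ((hh x).const_smul c) (fun t => by simp [h₀]) hy } K
        fun x => (hh x).norm_le_of_boundary hu hv (h₀ x) (h₁ x) hy, fun _ => ⟨?_, fun x => rfl⟩⟩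
      exact LinearMap.mkContinuous_norm_le _ ((norm_nonneg _).trans (hu 0)) _
    · exact ⟨0, fun h => absurd h hy⟩
  choose Φ hΦ using evaluation
  have apply_eq : ∀ x, Set.EqOn (fun y => Φ y x) (h x) (strip z) := fun x y hy => (hΦ y hy).2 x
  refine ⟨Φ, ⟨fun x => (hh x).continuousOn.congr (apply_eq x), ?_⟩, fun y hy => (hΦ y hy).1,
    fun t x => (apply_eq x (ofReal_mem_strip z t)).trans (h₀ x t),
    fun t x => (apply_eq x (self_add_ofReal_mem_strip z t)).trans (h₁ x t)⟩
  exact analyticOnNhd_of_differentiableOn_apply isOpen_interior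
    (fun y hy => (hΦ y (interior_subset hy)).1) fun x =>
    (hh x).analyticOn.differentiableOn.congr fun y hy => apply_eq x (interior_subset hy)

end Boundary

/-! ### The graph of the analytic continuation -/

section Graph

variable {E : Type*} [NormedAddCommGroup E] [NormedSpace ℂ E] {α : OneParamRep E} {z : ℂ}

namespace OneParamRep

theorem add_apply (α : OneParamRep E) (s t : ℝ) (a : E) : α (s + t) a = α s (α t a) := by
  rw [α.map_add]; rfl

theorem zero_apply (α : OneParamRep E) (a : E) : α 0 a = a := by rw [α.map_zero]; rfl

theorem norm_apply_le (α : OneParamRep E) (t : ℝ) (a : E) : ‖α t a‖ ≤ ‖a‖ := by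
  simpa only [one_mul] using (α t).le_of_opNorm_le (α.norm_le_one t) a

theorem neg_apply_apply (α : OneParamRep E) (t : ℝ) (a : E) : α (-t) (α t a) = a := by
  simpa only [neg_neg] using α.apply_neg_apply (-t) a

theorem norm_comp_le {V : Type*} [NormedAddCommGroup V] [NormedSpace ℂ V] (α : OneParamRep E)
    (t : ℝ) (T : V →L[ℂ] E) : ‖(α t).comp T‖ ≤ ‖T‖ :=
  ((α t).opNorm_comp_le T).trans (mul_le_of_le_one_left (norm_nonneg T) (α.norm_le_one t))

end OneParamRep

theorem exists_norm_le_of_apply_add {h : ℂ → E} (hc : ContinuousOn h (strip z))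
    (hα : ∀ y ∈ strip z, ∀ t : ℝ, h (y + t) = α t (h y)) : ∃ C, ∀ y ∈ strip z, ‖h y‖ ≤ C := by
  have vertical : ContinuousOn (fun s : ℝ => h (s * Complex.I)) (Set.uIcc 0 z.im) :=
    hc.comp (by fun_prop) fun s hs => by simpa [strip] using hs
  obtain ⟨C, hC⟩ := isCompact_uIcc.exists_bound_of_continuousOn vertical
  refine ⟨C, fun y hy => ?_⟩
  rw [← Complex.re_add_im y, add_comm, hα _ (by simpa [strip] using hy)]
  exact (α.norm_apply_le _ _).trans (hC _ hy)

theorem IsContinuation.apply_add {a : E} {f : ℂ → E} (hf : IsContinuation α z a f) {y : ℂ}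
    (hy : y ∈ strip z) (t : ℝ) : f (y + t) = α t (f y) := by
  have maps_interior : Set.MapsTo (fun w : ℂ => w + t) (interior (strip z))
      (interior (strip z)) := by
    intro w hw
    rw [interior_strip] at hw ⊢
    simpa using hw
  refine sub_eq_zero.1 (eqOn_zero_strip (f := fun w => f (w + t) - α t (f w)) ?_ ?_ ?_ hy)
  · exact (hf.continuousOn.comp (by fun_prop) fun w hw => add_ofReal_mem_strip hw t).sub
      ((α t).continuous.comp_continuousOn hf.continuousOn)
  · intro w hw
    exact ((hf.analyticOn _ (maps_interior hw)).fun_comp (f := fun w : ℂ => w + t)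
      (by fun_prop)).sub (((α t).analyticAt _).comp (hf.analyticOn w hw))
  · intro s
    rw [← Complex.ofReal_add, ← hf.eq_real, ← hf.eq_real, add_comm, α.add_apply, sub_self]

theorem IsContinuation.isStripHolomorphic {a : E} {f : ℂ → E} (hf : IsContinuation α z a f) :
    IsStripHolomorphic z f :=
  ⟨hf.continuousOn, hf.analyticOn,
    exists_norm_le_of_apply_add hf.continuousOn fun _ hy => hf.apply_add hy⟩

theorem analyticGraph_eq_boundarySubmodule (α : OneParamRep E) (z : ℂ) :
    analyticGraph α z = boundarySubmodule z
      (fun t => (α t).comp (ContinuousLinearMap.fst ℂ E E))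
      (fun t => (α t).comp (ContinuousLinearMap.snd ℂ E E)) := by
  ext p
  constructor
  · rintro ⟨f, hf, hfz⟩
    exact ⟨f, hf.isStripHolomorphic, fun t => (hf.eq_real t).symm,
      fun t => by simp [hf.apply_add (self_mem_strip z), hfz]⟩
  · rintro ⟨h, hh, h₀, h₁⟩
    exact ⟨h, ⟨hh.continuousOn, hh.analyticOn, fun t => (h₀ t).symm⟩,
      by simpa [α.zero_apply] using h₁ 0⟩

theorem isClosed_analyticGraph [CompleteSpace E] (α : OneParamRep E) (z : ℂ) :
    IsClosed (analyticGraph α z : Set (E × E)) := by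
  rw [analyticGraph_eq_boundarySubmodule]
  exact isClosed_boundarySubmodule
    (fun t => (α.norm_comp_le t _).trans (ContinuousLinearMap.norm_fst_le ℂ E E))
    (fun t => (α.norm_comp_le t _).trans (ContinuousLinearMap.norm_snd_le ℂ E E))

theorem exists_analyticGraph_evaluation [CompleteSpace E] (α : OneParamRep E) (z : ℂ) :
    ∃ Φ : ℂ → analyticGraph α z →L[ℂ] E, IsStrongStripHolomorphic z Φ ∧
      (∀ y ∈ strip z, ‖Φ y‖ ≤ 1) ∧ (∀ (t : ℝ) (p), Φ t p = α t p.1.1) ∧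
      ∀ (t : ℝ) (p), Φ (z + t) p = α t p.1.2 := by
  rw [analyticGraph_eq_boundarySubmodule]
  exact exists_boundary_evaluation
    (fun t => (α.norm_comp_le t _).trans (ContinuousLinearMap.norm_fst_le ℂ E E))
    (fun t => (α.norm_comp_le t _).trans (ContinuousLinearMap.norm_snd_le ℂ E E))

end Graph

/-! ### Entire orbits and Gaussian smearing -/

theorem differentiableAt_integral_of_dominated {S E : Type*} [MeasurableSpace S]
    {μ : MeasureTheory.Measure S} [NormedAddCommGroup E] [NormedSpace ℂ E] {F : ℂ → S → E} {w₀ : ℂ}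
    {r : ℝ} (hr : 0 < r) {bound : S → ℝ}
    (hmeas : ∀ w ∈ Metric.ball w₀ r, MeasureTheory.AEStronglyMeasurable (F w) μ)
    (hdiff : ∀ s, DifferentiableOn ℂ (fun w => F w s) (Metric.ball w₀ r))
    (hbound : ∀ s, ∀ w ∈ Metric.ball w₀ r, ‖F w s‖ ≤ bound s)
    (hint : MeasureTheory.Integrable bound μ) :
    DifferentiableAt ℂ (fun w => ∫ s, F w s ∂μ) w₀ := by
  have hasDerivAt : ∀ s, ∀ w ∈ Metric.ball w₀ r,
      HasDerivAt (fun w => F w s) (deriv (fun w => F w s) w) w := fun s w hw =>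
    ((hdiff s).differentiableAt (Metric.isOpen_ball.mem_nhds hw)).hasDerivAt
  have deriv_meas : MeasureTheory.AEStronglyMeasurable
      (fun s => deriv (fun w => F w s) w₀) μ := by
    obtain ⟨c, hc, hc₀⟩ := mem_closure_iff_seq_limit.1 <|
      (dense_compl_singleton w₀).open_subset_closure_inter Metric.isOpen_ball
        (Metric.mem_ball_self (x := w₀) hr)
    exact aestronglyMeasurable_of_tendsto_ae atTop (f := fun n s => slope (fun w => F w s) w₀ (c n))
      (fun n => ((hmeas _ (hc n).1).sub (hmeas _ (Metric.mem_ball_self hr))).const_smul _)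
      (.of_forall fun s => (hasDerivAt_iff_tendsto_slope.1
        (hasDerivAt s w₀ (Metric.mem_ball_self hr))).comp
          (tendsto_nhdsWithin_iff.2 ⟨hc₀, .of_forall fun n => (hc n).2⟩))
  have deriv_le : ∀ s, ∀ w ∈ Metric.ball w₀ (r / 2),
      ‖deriv (fun w => F w s) w‖ ≤ bound s / (r / 2) := by
    intro s w hw
    have hsub : Metric.closedBall w (r / 2) ⊆ Metric.ball w₀ r :=
      Metric.closedBall_subset_ball' (by linarith [Metric.mem_ball.1 hw])
    exact Complex.norm_deriv_le_of_forall_mem_sphere_norm_le (half_pos hr)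
      ((hdiff s).mono hsub |>.diffContOnCl_ball subset_rfl)
      fun ζ hζ => hbound s ζ (hsub (Metric.sphere_subset_closedBall hζ))
  refine (hasDerivAt_integral_of_dominated_loc_of_deriv_le
    (Metric.ball_mem_nhds w₀ (half_pos hr)) ?_ ?_ deriv_meas (.of_forall deriv_le)
    (hint.div_const _) (.of_forall fun s w hw =>
      hasDerivAt s w (Metric.ball_subset_ball (half_le_self hr.le) hw))).2.differentiableAt
  · exact eventually_of_mem (Metric.ball_mem_nhds w₀ hr) hmeas
  · exact hint.mono' (hmeas _ (Metric.mem_ball_self hr))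
      (.of_forall fun s => hbound s _ (Metric.mem_ball_self hr))

/-- The Gaussian kernel with complex mean `w`, normalised to have integral one. -/
noncomputable def gaussianKernel (w : ℂ) (s : ℝ) : ℂ :=
  ((Real.pi : ℂ) ^ (1 / 2 : ℂ))⁻¹ * Complex.exp (-((s : ℂ) - w) ^ 2)

theorem continuous_gaussianKernel (w : ℂ) : Continuous (gaussianKernel w) := by
  unfold gaussianKernel
  fun_prop

theorem integrable_gaussianKernel (w : ℂ) : MeasureTheory.Integrable (gaussianKernel w) := by
  refine MeasureTheory.Integrable.const_mul ?_ _
  convert integrable_cexp_quadratic' (b := -1) (by simp) (2 * w) (-w ^ 2) using 3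
  ring

theorem integral_gaussianKernel (w : ℂ) : ∫ s, gaussianKernel w s = 1 := by
  have h := integral_cexp_quadratic (b := -1) (by simp) (2 * w) (-w ^ 2)
  rw [show -w ^ 2 - (2 * w) ^ 2 / (4 * -1) = 0 by ring, Complex.exp_zero, mul_one, neg_neg,
    div_one] at h
  have expand : ∀ s : ℝ, -((s : ℂ) - w) ^ 2 = -1 * (s : ℂ) ^ 2 + 2 * w * s + -w ^ 2 :=
    fun s => by ring
  simp only [gaussianKernel, expand]
  rw [MeasureTheory.integral_const_mul, h]
  exact inv_mul_cancel₀ (by simp [Complex.cpow_eq_zero_iff, Real.pi_ne_zero])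

theorem gaussianKernel_add (w : ℂ) (s t : ℝ) :
    gaussianKernel (w + t) (s + t) = gaussianKernel w s := by
  simp only [gaussianKernel, Complex.ofReal_add, add_sub_add_right_eq_sub]

theorem norm_gaussianKernel_le (w : ℂ) (s : ℝ) :
    ‖gaussianKernel w s‖ ≤ ‖((Real.pi : ℂ) ^ (1 / 2 : ℂ))⁻¹‖ *
      (Real.exp (‖w‖ ^ 2) * Real.exp (-(1 / 2) * s ^ 2)) := by
  rw [gaussianKernel, norm_mul, Complex.norm_exp, ← Real.exp_add]
  gcongr
  have hw : ‖w‖ ^ 2 = w.re ^ 2 + w.im ^ 2 := by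
    rw [← Complex.normSq_eq_norm_sq, Complex.normSq_apply]
    ring
  have hre : (-((s : ℂ) - w) ^ 2).re = -(s - w.re) ^ 2 + w.im ^ 2 := by simp [pow_two]; ring
  rw [hw, hre]
  linarith [sq_nonneg (s - 2 * w.re)]

section EntireOrbits

variable {E : Type*} [NormedAddCommGroup E] [NormedSpace ℂ E] {α : OneParamRep E}

theorem integrable_gaussianKernel_smul {φ : ℝ → E} (hφ : Continuous φ) {C : ℝ}
    (hC : ∀ s, ‖φ s‖ ≤ C) (w : ℂ) :
    MeasureTheory.Integrable fun s => gaussianKernel w s • φ s :=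
  (integrable_gaussianKernel w).smul_bdd C hφ.aestronglyMeasurable (.of_forall hC)

theorem differentiable_integral_gaussianKernel_smul {φ : ℝ → E} (hφ : Continuous φ) {C : ℝ}
    (hC : ∀ s, ‖φ s‖ ≤ C) : Differentiable ℂ fun w => ∫ s, gaussianKernel w s • φ s := by
  intro w₀
  have integrable_bound : MeasureTheory.Integrable fun s : ℝ =>
      ‖((Real.pi : ℂ) ^ (1 / 2 : ℂ))⁻¹‖ *
        (Real.exp ((‖w₀‖ + 1) ^ 2) * Real.exp (-(1 / 2) * s ^ 2)) * C :=
    (((integrable_exp_neg_mul_sq one_half_pos).const_mul _).const_mul _).mul_const _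
  refine differentiableAt_integral_of_dominated one_pos
    (fun w _ => ((continuous_gaussianKernel w).smul hφ).aestronglyMeasurable)
    (fun s => ?_) (fun s w hw => ?_) integrable_bound
  · unfold gaussianKernel
    fun_prop
  · have hw' : ‖w‖ ≤ ‖w₀‖ + 1 := norm_le_of_mem_closedBall (Metric.ball_subset_closedBall hw)
    rw [norm_smul]
    refine mul_le_mul ((norm_gaussianKernel_le w s).trans ?_) (hC s) (norm_nonneg _)
      (by positivity)
    gcongr

/-- `g` is an entire function that extends the orbit `t ↦ α_t (g 0)`. -/
structure IsEntireOrbit (α : OneParamRep E) (g : ℂ → E) : Prop where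
  differentiable : Differentiable ℂ g
  apply_add : ∀ (w : ℂ) (t : ℝ), g (w + t) = α t (g w)

theorem IsEntireOrbit.mem_analyticGraph [CompleteSpace E] {g : ℂ → E} (hg : IsEntireOrbit α g)
    (w z : ℂ) : (g w, g (w + z)) ∈ analyticGraph α z := by
  have hd : Differentiable ℂ fun y => g (w + y) := hg.differentiable.comp (by fun_prop)
  exact ⟨fun y => g (w + y), ⟨hd.continuous.continuousOn, fun y _ => hd.analyticAt y,
    fun t => (hg.apply_add w t).symm⟩, rfl⟩

theorem IsEntireOrbit.exists_norm_le {g : ℂ → E} (hg : IsEntireOrbit α g) (z : ℂ) :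
    ∃ C, ∀ y ∈ strip z, ‖g y‖ ≤ C :=
  exists_norm_le_of_apply_add hg.differentiable.continuous.continuousOn
    fun y _ => hg.apply_add y

/-- The Gaussian average of the orbit of `x`. -/
noncomputable def gaussianSmear (α : OneParamRep E) (x : E) (w : ℂ) : E :=
  ∫ s, gaussianKernel w s • α s x

theorem isEntireOrbit_gaussianSmear [CompleteSpace E] (hα : α.StronglyContinuous) (x : E) :
    IsEntireOrbit α (gaussianSmear α x) where
  differentiable :=
    differentiable_integral_gaussianKernel_smul (hα x) fun s => α.norm_apply_le s x
  apply_add w t := by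
    rw [gaussianSmear, gaussianSmear, ← ContinuousLinearMap.integral_comp_comm _
      (integrable_gaussianKernel_smul (hα x) (fun s => α.norm_apply_le s x) w),
      ← MeasureTheory.integral_add_right_eq_self _ t]
    simp only [map_smul, gaussianKernel_add, ← α.add_apply, add_comm t]

/-- The representation `t ↦ α_{rt}`. Smearing its orbits amounts to averaging those of `α` over a
Gaussian of width `r`. -/
def OneParamRep.rescale (α : OneParamRep E) (r : ℝ) : OneParamRep E where
  toFun t := α (r * t)
  map_add s t := by rw [mul_add, α.map_add]
  map_zero := by rw [mul_zero, α.map_zero]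
  norm_le_one t := α.norm_le_one _

theorem OneParamRep.rescale_apply (α : OneParamRep E) (r t : ℝ) :
    α.rescale r t = α (r * t) := rfl

theorem OneParamRep.StronglyContinuous.rescale (hα : α.StronglyContinuous) (r : ℝ) :
    (α.rescale r).StronglyContinuous := fun a => (hα a).comp (continuous_const_mul r)

theorem IsEntireOrbit.of_rescale {r : ℝ} (hr : r ≠ 0) {g : ℂ → E}
    (hg : IsEntireOrbit (α.rescale r) g) : IsEntireOrbit α fun w => g (w / r) where
  differentiable := hg.differentiable.comp (by fun_prop)
  apply_add w t := by
    rw [add_div, ← Complex.ofReal_div, hg.apply_add, OneParamRep.rescale_apply,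
      mul_div_cancel₀ _ hr]

theorem continuous_gaussianSmear_rescale (hα : α.StronglyContinuous) (x : E) (w : ℂ) :
    Continuous fun r => gaussianSmear (α.rescale r) x w := by
  refine MeasureTheory.continuous_of_dominated (bound := fun s => ‖gaussianKernel w s‖ * ‖x‖)
    (fun r => ((continuous_gaussianKernel w).smul (hα.rescale r x)).aestronglyMeasurable)
    (fun r => .of_forall fun s => ?_) ((integrable_gaussianKernel w).norm.mul_const _)
    (.of_forall fun s => ?_)
  · rw [norm_smul]
    gcongr
    exact (α.rescale r).norm_apply_le s x
  · exact ((hα x).comp (continuous_mul_const s)).const_smul _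

theorem gaussianSmear_rescale_zero [CompleteSpace E] (α : OneParamRep E) (x : E) (w : ℂ) :
    gaussianSmear (α.rescale 0) x w = x := by
  simp only [gaussianSmear, OneParamRep.rescale_apply, zero_mul, α.zero_apply]
  rw [integral_smul_const, integral_gaussianKernel, one_smul]

theorem dense_isEntireOrbit [CompleteSpace E] (hα : α.StronglyContinuous) :
    Dense {x : E | ∃ g, IsEntireOrbit α g ∧ g 0 = x} := by
  intro x
  have lim : Tendsto (fun r => gaussianSmear (α.rescale r) x 0) (𝓝[≠] 0) (𝓝 x) := by
    simpa only [gaussianSmear_rescale_zero] using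
      ((continuous_gaussianSmear_rescale hα x 0).tendsto 0).mono_left nhdsWithin_le_nhds
  refine mem_closure_of_tendsto lim ?_
  filter_upwards [self_mem_nhdsWithin] with r hr
  exact ⟨_, (isEntireOrbit_gaussianSmear (hα.rescale r) x).of_rescale hr, by simp⟩

end EntireOrbits

/-! ### Intertwining operators -/

section Intertwiners

variable {X Y : Type*} [NormedAddCommGroup X] [NormedSpace ℂ X] [NormedAddCommGroup Y]
  [NormedSpace ℂ Y] {δ : OneParamRep X} {α : OneParamRep Y} {z : ℂ} {T S : X →L[ℂ] Y}

namespace OneParamRep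

/-- The orbit `t ↦ α_t T δ_{-t}` of an operator `T`. -/
def conj (α : OneParamRep Y) (δ : OneParamRep X) (T : X →L[ℂ] Y) (t : ℝ) : X →L[ℂ] Y :=
  (α t).comp (T.comp (δ (-t)))

theorem conj_apply (α : OneParamRep Y) (δ : OneParamRep X) (T : X →L[ℂ] Y) (t : ℝ) (x : X) :
    α.conj δ T t x = α t (T (δ (-t) x)) := rfl

theorem conj_zero (α : OneParamRep Y) (δ : OneParamRep X) (T : X →L[ℂ] Y) :
    α.conj δ T 0 = T := by
  ext x
  rw [conj_apply, neg_zero, δ.zero_apply, α.zero_apply]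

theorem norm_conj_le (α : OneParamRep Y) (δ : OneParamRep X) (T : X →L[ℂ] Y) (t : ℝ) :
    ‖α.conj δ T t‖ ≤ ‖T‖ :=
  (α.norm_comp_le t _).trans ((T.opNorm_comp_le _).trans
    (mul_le_of_le_one_right (norm_nonneg T) (δ.norm_le_one (-t))))

end OneParamRep

theorem IsEntireOrbit.map_neg {g : ℂ → X} (hg : IsEntireOrbit δ g) (t : ℝ) :
    g (-t) = δ (-t) (g 0) := by
  simpa only [Complex.ofReal_neg, zero_add] using hg.apply_add 0 (-t)

/-- `L` continues the orbit `t ↦ α_t T δ_{-t}` of the operator `T` to the strip `S(z)`. -/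
structure IsOperatorContinuation (δ : OneParamRep X) (α : OneParamRep Y) (z : ℂ) (T : X →L[ℂ] Y)
    (L : ℂ → X →L[ℂ] Y) : Prop extends IsStrongStripHolomorphic z L where
  eq_real : ∀ t : ℝ, L t = α.conj δ T t

theorem IsOperatorContinuation.congr {L L' : ℂ → X →L[ℂ] Y}
    (hL : IsOperatorContinuation δ α z T L) (h : Set.EqOn L' L (strip z)) :
    IsOperatorContinuation δ α z T L' where
  continuousOn_apply x := (hL.continuousOn_apply x).congr fun y hy => by rw [h hy]
  analyticOn := hL.analyticOn.congr isOpen_interior (h.symm.mono interior_subset)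
  eq_real t := (h (ofReal_mem_strip z t)).trans (hL.eq_real t)

variable [CompleteSpace Y]

theorem IsEntireOrbit.mem_boundarySubmodule_conj [CompleteSpace X]
    (hTS : ∀ c c', (c, c') ∈ analyticGraph δ z → (T c, S c') ∈ analyticGraph α z)
    {g : ℂ → X} (hg : IsEntireOrbit δ g) :
    g 0 ∈ boundarySubmodule z (α.conj δ T) (α.conj δ S) := by
  have := (isClosed_analyticGraph α z).completeSpace_coe
  obtain ⟨Φ, hΦ, hΦ₁, hΦ₀, hΦz⟩ := exists_analyticGraph_evaluation α z
  -- `Φ y (P y)` stands for `α_y T δ_{-y}` applied to `g 0`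
  let P : ℂ → analyticGraph α z := fun y =>
    ⟨(T (g (-y)), S (g (-y + z))), hTS _ _ (hg.mem_analyticGraph _ _)⟩
  have hP : Differentiable ℂ P := fun y => by
    refine differentiableAt_of_linearIsometry_comp (analyticGraph α z).subtypeₗᵢ ?_
    have := hg.differentiable
    change DifferentiableAt ℂ (fun y => (T (g (-y)), S (g (-y + z)))) y
    fun_prop
  have P_bounded : ∃ C, ∀ y ∈ strip z, ‖P y‖ ≤ C := by
    obtain ⟨C, hC⟩ := hg.exists_norm_le z
    obtain ⟨C', hC'⟩ := hg.exists_norm_le (-z)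
    refine ⟨max (‖T‖ * C') (‖S‖ * C), fun y hy =>
      max_le_max (T.le_opNorm_of_le (hC' _ ?_)) (S.le_opNorm_of_le (hC _ ?_))⟩
    all_goals
      simp only [strip, Set.mem_ofPred_eq, Set.mem_uIcc, Complex.add_im, Complex.neg_im] at hy ⊢
      grind
  obtain ⟨C, hC⟩ := P_bounded
  have h_norm : ∀ y ∈ strip z, ‖Φ y (P y)‖ ≤ 1 * C := fun y hy =>
    (Φ y).le_of_opNorm_le_of_le (hΦ₁ y hy) (hC y hy)
  refine ⟨fun y => Φ y (P y), ⟨hΦ.continuousOn_clm_apply hP.continuous.continuousOn,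
    hΦ.analyticOn_clm_apply hP.differentiableOn, _, h_norm⟩, fun t => ?_, fun t => ?_⟩
  · simp only [hΦ₀, P, hg.map_neg, OneParamRep.conj_apply]
  · simp only [hΦz, P, neg_add_rev, neg_add_cancel_right, hg.map_neg, OneParamRep.conj_apply]

theorem boundarySubmodule_conj_eq_top [CompleteSpace X] (hδ : δ.StronglyContinuous)
    (hTS : ∀ c c', (c, c') ∈ analyticGraph δ z → (T c, S c') ∈ analyticGraph α z) :
    boundarySubmodule z (α.conj δ T) (α.conj δ S) = ⊤ := by
  rw [eq_top_iff]
  intro x _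
  have closed : IsClosed (boundarySubmodule z (α.conj δ T) (α.conj δ S) : Set X) :=
    isClosed_boundarySubmodule (fun t => (α.norm_conj_le δ T t).trans (le_max_left _ ‖S‖))
      fun t => (α.norm_conj_le δ S t).trans (le_max_right ‖T‖ _)
  refine closed.closure_subset_iff.2 ?_ (dense_isEntireOrbit hδ x)
  rintro _ ⟨g, hg, rfl⟩
  exact hg.mem_boundarySubmodule_conj hTS

theorem exists_isOperatorContinuation [CompleteSpace X] (hδ : δ.StronglyContinuous)
    (hTS : ∀ c c', (c, c') ∈ analyticGraph δ z → (T c, S c') ∈ analyticGraph α z) :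
    ∃ L, IsOperatorContinuation δ α z T L ∧ L z = S := by
  obtain ⟨Φ, hΦ, -, hΦ₀, hΦz⟩ := exists_boundary_evaluation (z := z)
    (fun t => (α.norm_conj_le δ T t).trans (le_max_left _ ‖S‖))
    fun t => (α.norm_conj_le δ S t).trans (le_max_right ‖T‖ _)
  let ι : X →L[ℂ] boundarySubmodule z (α.conj δ T) (α.conj δ S) :=
    (ContinuousLinearMap.id ℂ X).codRestrict _ fun x => by
      rw [boundarySubmodule_conj_eq_top hδ hTS]
      exact Submodule.mem_top
  refine ⟨fun y => (Φ y).comp ι, ⟨⟨fun x => hΦ.continuousOn_apply (ι x), ?_⟩, fun t => ?_⟩, ?_⟩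
  · rw [Complex.analyticOnNhd_iff_differentiableOn isOpen_interior]
    exact hΦ.analyticOn.differentiableOn.clm_comp (differentiableOn_const _)
  · ext x
    exact hΦ₀ t (ι x)
  · ext x
    have h := hΦz 0 (ι x)
    rw [Complex.ofReal_zero, add_zero, OneParamRep.conj_zero] at h
    exact h

theorem IsOperatorContinuation.apply_mem_analyticGraph [CompleteSpace X] {L : ℂ → X →L[ℂ] Y}
    (hL : IsOperatorContinuation δ α z T L) {c c' : X} (hc : (c, c') ∈ analyticGraph δ z) :
    (T c, L z c') ∈ analyticGraph α z := by
  obtain ⟨g, hg, rfl⟩ := hc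
  refine ⟨fun y => L y (g y), ⟨hL.continuousOn_clm_apply hg.continuousOn,
    hL.analyticOn_clm_apply hg.analyticOn.differentiableOn, fun t => ?_⟩, rfl⟩
  rw [hL.eq_real, ← hg.eq_real, OneParamRep.conj_apply, δ.neg_apply_apply]

theorem exists_isOperatorContinuation_iff [CompleteSpace X] (hδ : δ.StronglyContinuous) :
    (∃ L, IsOperatorContinuation δ α z T L ∧ L z = S) ↔
      ∀ c c', (c, c') ∈ analyticGraph δ z → (T c, S c') ∈ analyticGraph α z := by
  refine ⟨?_, exists_isOperatorContinuation hδ⟩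
  rintro ⟨L, hL, rfl⟩ c c' hc
  exact hL.apply_mem_analyticGraph hc

end Intertwiners

/-! ### Averages of operators that tend strongly to zero -/

section StrongLimits

variable {ι V E : Type*} [NormedAddCommGroup V] [NormedSpace ℂ V] [NormedAddCommGroup E]
  [NormedSpace ℂ E] {l : Filter ι} {D : ι → V →L[ℂ] E} {C : ℝ}

theorem isClosed_setOfPred_tendsto_zero (hC : ∀ᶠ i in l, ‖D i‖ ≤ C) :
    IsClosed {x | Tendsto (fun i => D i x) l (𝓝 0)} := by
  refine isClosed_of_closure_subset fun x hx => Metric.tendsto_nhds.2 fun ε hε => ?_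
  obtain ⟨y, hy, hxy⟩ := Metric.mem_closure_iff.1 hx (ε / (2 * (|C| + 1))) (by positivity)
  rw [dist_eq_norm, lt_div_iff₀ (by positivity)] at hxy
  filter_upwards [hC, Metric.tendsto_nhds.1 hy (ε / 2) (half_pos hε)] with i hi hiy
  rw [dist_zero_right] at hiy ⊢
  calc ‖D i x‖ = ‖D i (x - y) + D i y‖ := by rw [map_sub, sub_add_cancel]
    _ ≤ |C| * ‖x - y‖ + ‖D i y‖ := norm_add_le_of_le
        ((D i).le_of_opNorm_le (hi.trans (le_abs_self C)) _) le_rfl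
    _ < ε := by linarith [norm_nonneg (x - y)]

variable {S : Type*} [MeasurableSpace S] {μ : MeasureTheory.Measure S}

theorem tendsto_compLpL_zero (hC : ∀ᶠ i in l, ‖D i‖ ≤ C)
    (hD : ∀ x, Tendsto (fun i => D i x) l (𝓝 0)) (f : MeasureTheory.Lp V 1 μ) :
    Tendsto (fun i => (D i).compLpL 1 μ f) l (𝓝 0) := by
  refine MeasureTheory.Lp.induction ENNReal.one_ne_top
    (motive := fun f => Tendsto (fun i => (D i).compLpL 1 μ f) l (𝓝 0)) ?_ ?_ ?_ f
  · intro c s hs hμs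
    have compLp_indicator : ∀ i, (D i).compLpL 1 μ
        (MeasureTheory.Lp.simpleFunc.indicatorConst 1 hs hμs.ne c : MeasureTheory.Lp V 1 μ) =
          MeasureTheory.indicatorConstLp 1 hs hμs.ne (D i c) := by
      intro i
      rw [MeasureTheory.Lp.simpleFunc.coe_indicatorConst]
      ext1
      filter_upwards [(D i).coeFn_compLpL (MeasureTheory.indicatorConstLp 1 hs hμs.ne c),
        MeasureTheory.indicatorConstLp_coeFn (p := 1) (hs := hs) (hμs := hμs.ne) (c := c),
        MeasureTheory.indicatorConstLp_coeFn (p := 1) (hs := hs) (hμs := hμs.ne) (c := D i c)]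
        with a h₁ h₂ h₃
      rw [h₁, h₂, h₃]
      exact (congrFun (Set.indicator_comp_of_zero (map_zero (D i))) a).symm
    simp only [compLp_indicator]
    refine squeeze_zero_norm (fun i => MeasureTheory.norm_indicatorConstLp_le) ?_
    simpa only [norm_zero, zero_mul] using (hD c).norm.mul_const _
  · intro f g hf hg _ hf₀ hg₀
    simpa only [map_add, add_zero] using hf₀.add hg₀
  · refine isClosed_setOfPred_tendsto_zero (C := C) ?_
    filter_upwards [hC] with i hi using ((D i).norm_compLpL_le).trans hi

theorem tendsto_integral_norm_apply_zero (hC : ∀ᶠ i in l, ‖D i‖ ≤ C)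
    (hD : ∀ x, Tendsto (fun i => D i x) l (𝓝 0)) {f : S → V} (hf : MeasureTheory.Integrable f μ) :
    Tendsto (fun i => ∫ s, ‖D i (f s)‖ ∂μ) l (𝓝 0) := by
  have h := (tendsto_compLpL_zero hC hD (hf.toL1 f)).norm
  rw [norm_zero] at h
  refine h.congr fun i => ?_
  rw [MeasureTheory.L1.norm_eq_integral_norm]
  refine MeasureTheory.integral_congr_ae ?_
  filter_upwards [(D i).coeFn_compLpL (hf.toL1 f), hf.coeFn_toL1] with s h₁ h₂
  rw [h₁, h₂]

end StrongLimits

theorem tendsto_integral_gaussianKernel_smul_conj {ι X Y : Type*} [NormedAddCommGroup X]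
    [NormedSpace ℂ X] [NormedAddCommGroup Y] [NormedSpace ℂ Y] {l : Filter ι} {δ : OneParamRep X}
    (hδ : δ.StronglyContinuous) (α : OneParamRep Y) {D : ι → X →L[ℂ] Y} {C : ℝ}
    (hC : ∀ᶠ i in l, ‖D i‖ ≤ C) (hD : ∀ x, Tendsto (fun i => D i x) l (𝓝 0)) (w : ℂ) (x : X) :
    Tendsto (fun i => ∫ s, gaussianKernel w s • α.conj δ (D i) s x) l (𝓝 0) := by
  have hf : MeasureTheory.Integrable fun s => gaussianKernel w s • δ (-s) x :=
    integrable_gaussianKernel_smul ((hδ x).comp continuous_neg)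
      (fun s => δ.norm_apply_le (-s) x) w
  refine squeeze_zero_norm (fun i => ?_) (tendsto_integral_norm_apply_zero hC hD hf)
  refine MeasureTheory.norm_integral_le_of_norm_le ((D i).integrable_comp hf).norm
    (.of_forall fun s => ?_)
  simpa only [OneParamRep.conj_apply, map_smul] using
    α.norm_apply_le s (D i (gaussianKernel w s • δ (-s) x))

/-! ### The strict continuation in terms of intertwining relations -/

section Multipliers

variable {A : Type*} [NonUnitalCStarAlgebra A] {α β γ : OneParamRep A} {z : ℂ}

/-- `β` and `γ` witness the semi-multiplicativity of `α`. -/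
structure OneParamRep.SemiMultiplicativeWith (α β γ : OneParamRep A) : Prop where
  mul_apply : ∀ (t : ℝ) (b a : A), β t b * α t a = α t (b * a)
  apply_mul : ∀ (t : ℝ) (a b : A), α t a * γ t b = α t (a * b)

theorem OneParamRep.SemiMultiplicative.exists_semiMultiplicativeWith (hα : α.SemiMultiplicative) :
    ∃ β γ : OneParamRep A, β.StronglyContinuous ∧ γ.StronglyContinuous ∧
      α.SemiMultiplicativeWith β γ :=
  let ⟨β, γ, hβ, hγ, h⟩ := hα
  ⟨β, γ, hβ, hγ, fun t b a => (h t a b).1, fun t a b => (h t a b).2⟩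

theorem OneParamRep.SemiMultiplicativeWith.map_mul (hm : α.SemiMultiplicativeWith β γ) (t : ℝ)
    (a b : A) : γ t (a * b) = γ t a * γ t b := by
  rw [← sub_eq_zero]
  refine eq_zero_of_forall_mul fun x => ?_
  rw [← α.apply_neg_apply t x, mul_sub, ← mul_assoc, hm.apply_mul, hm.apply_mul, hm.apply_mul,
    mul_assoc, sub_self]

theorem continuous_strict_fst (b : A) :
    Continuous fun m : StrictMultiplier A => ((toStrict A).symm m).fst b :=
  (continuous_apply b).comp (continuous_fst.comp (continuous_induced_dom (f := actions A)))

theorem continuous_strict_snd (b : A) :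
    Continuous fun m : StrictMultiplier A => ((toStrict A).symm m).snd b :=
  (continuous_apply b).comp (continuous_snd.comp (continuous_induced_dom (f := actions A)))

/-- The extension of `α_t` to multipliers, given by `m b ↦ α_t (m γ_{-t} b)` on the left and by
`b m ↦ α_t (β_{-t} b m)` on the right. -/
noncomputable def conjMultiplier (hm : α.SemiMultiplicativeWith β γ) (t : ℝ) :
    𝓜(ℂ, A) →ₗ[ℂ] 𝓜(ℂ, A) where
  toFun m :=
    { fst := α.conj γ m.fst t
      snd := α.conj β m.snd t
      central := fun x y => by
        nth_rw 2 [← β.apply_neg_apply t x]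
        nth_rw 1 [← γ.apply_neg_apply t y]
        rw [α.conj_apply, α.conj_apply, hm.mul_apply, hm.apply_mul, m.central] }
  map_add' m n := multiplier_ext (fun _ => map_add (α t) _ _) (fun _ => map_add (α t) _ _)
  map_smul' c m := multiplier_ext (fun _ => map_smul (α t) _ _) (fun _ => map_smul (α t) _ _)

theorem isStrictExtension_conjMultiplier (hm : α.SemiMultiplicativeWith β γ) (t : ℝ) :
    IsStrictExtension (α t) (conjMultiplier hm t) where
  extends_coe a := multiplier_ext
    (fun b => show α t (a * γ (-t) b) = α t a * b by rw [← hm.apply_mul, γ.apply_neg_apply])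
    fun b => show α t (β (-t) b * a) = b * α t a by rw [← hm.mul_apply, β.apply_neg_apply]
  continuousOn_bounded _ _ := Continuous.continuousOn <| continuous_iff_continuousAt.2 fun m =>
    tendsto_strict_iff.2
      ⟨fun b => ((α t).continuous.comp (continuous_strict_fst (γ (-t) b))).tendsto m,
        fun b => ((α t).continuous.comp (continuous_strict_snd (β (-t) b))).tendsto m⟩

theorem strictExt_eq_conjMultiplier (hα : α.SemiMultiplicative)
    (hm : α.SemiMultiplicativeWith β γ) (t : ℝ) : strictExt hα t = conjMultiplier hm t :=
  (isStrictExtension_strictExt hα t).unique (isStrictExtension_conjMultiplier hm t)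

/-- The left action of multipliers, as a linear isometry. -/
noncomputable def fstIsometry (A : Type*) [NonUnitalCStarAlgebra A] :
    𝓜(ℂ, A) →ₗᵢ[ℂ] (A →L[ℂ] A) where
  toFun m := m.fst
  map_add' _ _ := rfl
  map_smul' _ _ := rfl
  norm_map' m := DoubleCentralizer.norm_fst m

/-- The right action of multipliers, as a linear isometry. -/
noncomputable def sndIsometry (A : Type*) [NonUnitalCStarAlgebra A] :
    𝓜(ℂ, A) →ₗᵢ[ℂ] (A →L[ℂ] A) where
  toFun m := m.snd
  map_add' _ _ := rfl
  map_smul' _ _ := rfl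
  norm_map' m := DoubleCentralizer.norm_snd m

theorem analyticOnNhd_of_fst {U : Set ℂ} (hU : IsOpen U) {f : ℂ → 𝓜(ℂ, A)}
    (hf : AnalyticOnNhd ℂ (fun y => (f y).fst) U) : AnalyticOnNhd ℂ f U := by
  rw [Complex.analyticOnNhd_iff_differentiableOn hU]
  exact fun y hy => (differentiableAt_of_linearIsometry_comp (fstIsometry A)
    (hf y hy).differentiableAt).differentiableWithinAt

theorem isStrictContinuation_iff (hα : α.SemiMultiplicative) (hm : α.SemiMultiplicativeWith β γ)
    {m : 𝓜(ℂ, A)} {f : ℂ → 𝓜(ℂ, A)} : IsStrictContinuation hα z m f ↔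
      IsOperatorContinuation γ α z m.fst (fun y => (f y).fst) ∧
      IsOperatorContinuation β α z m.snd fun y => (f y).snd := by
  constructor
  · intro hf
    have tendsto_f := fun y hy => tendsto_strict_iff.1 (hf.continuousOn y hy)
    have f_real : ∀ t : ℝ, f t = conjMultiplier hm t m := fun t => by
      rw [← hf.eq_real, strictExt_eq_conjMultiplier hα hm]
    constructor
    · exact ⟨⟨fun x y hy => (tendsto_f y hy).1 x,
        (fstIsometry A).toContinuousLinearMap.comp_analyticOnNhd hf.analyticOn⟩,
        fun t => by rw [f_real]; rfl⟩
    · exact ⟨⟨fun x y hy => (tendsto_f y hy).2 x,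
        (sndIsometry A).toContinuousLinearMap.comp_analyticOnNhd hf.analyticOn⟩,
        fun t => by rw [f_real]; rfl⟩
  · rintro ⟨hL, hR⟩
    refine ⟨fun y hy => tendsto_strict_iff.2 ⟨fun x => hL.continuousOn_apply x y hy,
      fun x => hR.continuousOn_apply x y hy⟩,
      analyticOnNhd_of_fst isOpen_interior hL.analyticOn, fun t => ?_⟩
    rw [strictExt_eq_conjMultiplier hα hm]
    exact multiplier_ext (fun x => (DFunLike.congr_fun (hL.eq_real t) x).symm)
      fun x => (DFunLike.congr_fun (hR.eq_real t) x).symm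

theorem IsOperatorContinuation.central (hm : α.SemiMultiplicativeWith β γ) {m : 𝓜(ℂ, A)}
    {L R : ℂ → A →L[ℂ] A} (hL : IsOperatorContinuation γ α z m.fst L)
    (hR : IsOperatorContinuation β α z m.snd R) {y : ℂ} (hy : y ∈ strip z) (a b : A) :
    R y a * b = a * L y b := by
  have hL' : AnalyticOnNhd ℂ (fun y => L y b) (interior (strip z)) :=
    (ContinuousLinearMap.apply ℂ A b).comp_analyticOnNhd hL.analyticOn
  have hR' : AnalyticOnNhd ℂ (fun y => R y a) (interior (strip z)) :=
    (ContinuousLinearMap.apply ℂ A a).comp_analyticOnNhd hR.analyticOn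
  refine sub_eq_zero.1 (eqOn_zero_strip (f := fun y => R y a * b - a * L y b)
    (((hR.continuousOn_apply a).mul continuousOn_const).sub
      (continuousOn_const.mul (hL.continuousOn_apply b)))
    ((((ContinuousLinearMap.mul ℂ A).flip b).comp_analyticOnNhd hR').sub
      ((ContinuousLinearMap.mul ℂ A a).comp_analyticOnNhd hL')) (fun t => ?_) hy)
  rw [hL.eq_real, hR.eq_real]
  exact sub_eq_zero.2 ((conjMultiplier hm t m).central a b)

theorem mem_strictGraph_iff_exists (hα : α.SemiMultiplicative)
    (hm : α.SemiMultiplicativeWith β γ) {m n : 𝓜(ℂ, A)} :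
    (toStrict A m, toStrict A n) ∈ strictGraph hα z ↔
      (∃ L, IsOperatorContinuation γ α z m.fst L ∧ L z = n.fst) ∧
      ∃ R, IsOperatorContinuation β α z m.snd R ∧ R z = n.snd := by
  constructor
  · rintro ⟨f, hf, hfz⟩
    obtain rfl : f z = n := (toStrict A).injective hfz
    obtain ⟨hL, hR⟩ := (isStrictContinuation_iff hα hm).1 hf
    exact ⟨⟨_, hL, rfl⟩, _, hR, rfl⟩
  · rintro ⟨⟨L, hL, hLz⟩, R, hR, hRz⟩
    have exists_multiplier : ∀ y ∈ strip z, ∃ k : 𝓜(ℂ, A), k.fst = L y ∧ k.snd = R y :=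
      fun y hy => ⟨⟨(L y, R y), hL.central hm hR hy⟩, rfl, rfl⟩
    choose! f hf using exists_multiplier
    obtain ⟨hz₁, hz₂⟩ := hf z (self_mem_strip z)
    refine ⟨f, (isStrictContinuation_iff hα hm).2 ⟨hL.congr fun y hy => (hf y hy).1,
      hR.congr fun y hy => (hf y hy).2⟩, congrArg (toStrict A) (multiplier_ext ?_ ?_)⟩
    · exact DFunLike.congr_fun (hz₁.trans hLz)
    · exact DFunLike.congr_fun (hz₂.trans hRz)

theorem mem_strictGraph_iff (hα : α.SemiMultiplicative) (hm : α.SemiMultiplicativeWith β γ)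
    (hβ : β.StronglyContinuous) (hγ : γ.StronglyContinuous) {m n : 𝓜(ℂ, A)} :
    (toStrict A m, toStrict A n) ∈ strictGraph hα z ↔
      (∀ c c', (c, c') ∈ analyticGraph γ z → (m.fst c, n.fst c') ∈ analyticGraph α z) ∧
      ∀ c c', (c, c') ∈ analyticGraph β z → (m.snd c, n.snd c') ∈ analyticGraph α z := by
  rw [mem_strictGraph_iff_exists hα hm, exists_isOperatorContinuation_iff hγ,
    exists_isOperatorContinuation_iff hβ]

theorem isClosed_strictGraph (hα : α.SemiMultiplicative) (z : ℂ) :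
    IsClosed (strictGraph hα z : Set (StrictMultiplier A × StrictMultiplier A)) := by
  obtain ⟨β, γ, hβ, hγ, hm⟩ := hα.exists_semiMultiplicativeWith
  have strictGraph_eq :
      (strictGraph hα z : Set (StrictMultiplier A × StrictMultiplier A)) =
        (⋂ q ∈ analyticGraph γ z, (fun p : StrictMultiplier A × StrictMultiplier A =>
          (((toStrict A).symm p.1).fst q.1, ((toStrict A).symm p.2).fst q.2)) ⁻¹'
            analyticGraph α z) ∩
        ⋂ q ∈ analyticGraph β z, (fun p : StrictMultiplier A × StrictMultiplier A =>
          (((toStrict A).symm p.1).snd q.1, ((toStrict A).symm p.2).snd q.2)) ⁻¹'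
            analyticGraph α z := by
    ext p
    simp only [Set.mem_inter_iff, Set.mem_iInter, Set.mem_preimage, Prod.forall]
    exact mem_strictGraph_iff hα hm hβ hγ
  rw [strictGraph_eq]
  refine .inter (isClosed_biInter fun q _ => ?_) (isClosed_biInter fun q _ => ?_)
  · exact (isClosed_analyticGraph α z).preimage
      (((continuous_strict_fst q.1).comp continuous_fst).prodMk
        ((continuous_strict_fst q.2).comp continuous_snd))
  · exact (isClosed_analyticGraph α z).preimage
      (((continuous_strict_snd q.1).comp continuous_fst).prodMk
        ((continuous_strict_snd q.2).comp continuous_snd))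

end Multipliers

/-! ### The strict core -/

theorem tendsto_apply_gaussianSmear {ι X Y : Type*} [NormedAddCommGroup X] [NormedSpace ℂ X]
    [CompleteSpace X] [NormedAddCommGroup Y] [NormedSpace ℂ Y] [CompleteSpace Y]
    {γ : OneParamRep X} {δ : OneParamRep Y} (hγ : γ.StronglyContinuous)
    (hδ : δ.StronglyContinuous) {B : X →L[ℂ] Y →L[ℂ] Y}
    (hB : ∀ t x y, δ t (B x y) = B (γ t x) (δ t y)) {l : Filter ι} {e : ι → X} {C : ℝ}
    (hC : ∀ᶠ i in l, ‖B (e i)‖ ≤ C) (he : ∀ y, Tendsto (fun i => B (e i) y) l (𝓝 y)) (w : ℂ)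
    (y : Y) : Tendsto (fun i => B (gaussianSmear γ (e i) w) y) l (𝓝 y) := by
  have lim := tendsto_integral_gaussianKernel_smul_conj hδ δ (l := l)
    (D := fun i => B (e i) - ContinuousLinearMap.id ℂ Y)
    (hC.mono fun i hi => norm_sub_le_of_le hi ContinuousLinearMap.norm_id_le)
    (fun y => tendsto_sub_nhds_zero_iff.2 (he y)) w y
  refine tendsto_sub_nhds_zero_iff.1 (lim.congr fun i => ?_)
  have conj_eq : ∀ s, gaussianKernel w s • δ.conj δ (B (e i) - ContinuousLinearMap.id ℂ Y) s y =
      B.flip y (gaussianKernel w s • γ s (e i)) - gaussianKernel w s • y := by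
    intro s
    simp only [OneParamRep.conj_apply, sub_apply, ContinuousLinearMap.id_apply,
      map_sub, hB, δ.apply_neg_apply, map_smul, ContinuousLinearMap.flip_apply, smul_sub]
  have integrable_smear :=
    integrable_gaussianKernel_smul (hγ (e i)) (fun s => γ.norm_apply_le s (e i)) w
  simp only [conj_eq]
  rw [MeasureTheory.integral_sub ((B.flip y).integrable_comp integrable_smear)
    ((integrable_gaussianKernel w).smul_const y), (B.flip y).integral_comp_comm integrable_smear,
    integral_smul_const, integral_gaussianKernel, one_smul]
  rfl

section Core

variable {A : Type*} [NonUnitalCStarAlgebra A] {α : OneParamRep A}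

theorem tendsto_gaussianSmear_mul {γ : OneParamRep A} (hγ : γ.StronglyContinuous)
    (hmul : ∀ (t : ℝ) (a b : A), γ t (a * b) = γ t a * γ t b) {l : Filter A}
    (hl : l.IsApproximateUnit) {C : ℝ} (hC : ∀ᶠ e in l, ‖e‖ ≤ C) (w : ℂ) (x : A) :
    Tendsto (fun e => gaussianSmear γ e w * x) l (𝓝 x) :=
  tendsto_apply_gaussianSmear (B := ContinuousLinearMap.mul ℂ A) (e := id) hγ hγ hmul
    (hC.mono fun e => (ContinuousLinearMap.opNorm_mul_apply_le ℂ A e).trans)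
    hl.tendsto_mul_right w x

theorem tendsto_mul_gaussianSmear {γ : OneParamRep A} (hγ : γ.StronglyContinuous)
    (hmul : ∀ (t : ℝ) (a b : A), γ t (a * b) = γ t a * γ t b) {l : Filter A}
    (hl : l.IsApproximateUnit) {C : ℝ} (hC : ∀ᶠ e in l, ‖e‖ ≤ C) (w : ℂ) (x : A) :
    Tendsto (fun e => x * gaussianSmear γ e w) l (𝓝 x) :=
  tendsto_apply_gaussianSmear (B := (ContinuousLinearMap.mul ℂ A).flip) (e := id) hγ hγ
    (fun t a b => hmul t b a)
    (hC.mono fun e => (ContinuousLinearMap.opNorm_mul_flip_apply ℂ e).le.trans)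
    hl.tendsto_mul_left w x

theorem tendsto_embed_fst {ι : Type*} {l : Filter ι} {b : ι → A}
    (h₁ : ∀ x, Tendsto (fun i => b i * x) l (𝓝 x))
    (h₂ : ∀ x, Tendsto (fun i => x * b i) l (𝓝 x)) (m : 𝓜(ℂ, A)) :
    Tendsto (fun i => embed A (m.fst (b i))) l (𝓝 (toStrict A m)) := by
  simp only [embed_apply]
  rw [tendsto_strict_iff]
  refine ⟨fun x => ?_, fun x => ?_⟩
  · simp only [DoubleCentralizer.coe_fst, ContinuousLinearMap.mul_apply', ← fst_mul]
    exact (m.fst.continuous.tendsto x).comp (h₁ x)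
  · simp only [DoubleCentralizer.coe_snd, ContinuousLinearMap.flip_apply,
      ContinuousLinearMap.mul_apply', ← m.central]
    exact h₂ _

theorem strictGraph_le_topologicalClosure (hα : α.SemiMultiplicative) (z : ℂ) :
    strictGraph hα z ≤
      ((analyticGraph α z).map ((embed A).prodMap (embed A))).topologicalClosure := by
  obtain ⟨β, γ, hβ, hγ, hm⟩ := hα.exists_semiMultiplicativeWith
  rintro ⟨m, n⟩ hmn
  obtain ⟨m, rfl⟩ := (toStrict A).surjective m
  obtain ⟨n, rfl⟩ := (toStrict A).surjective n
  let _ := CStarAlgebra.spectralOrder A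
  let _ := CStarAlgebra.spectralOrderedRing A
  have hu := CStarAlgebra.increasingApproximateUnit A
  have := hu.neBot
  have lim : ∀ (w : ℂ) (k : 𝓜(ℂ, A)), Tendsto (fun e => embed A (k.fst (gaussianSmear γ e w)))
      (CStarAlgebra.approximateUnit A) (𝓝 (toStrict A k)) := fun w k =>
    tendsto_embed_fst
      (tendsto_gaussianSmear_mul hγ hm.map_mul hu.toIsApproximateUnit hu.eventually_norm w)
      (tendsto_mul_gaussianSmear hγ hm.map_mul hu.toIsApproximateUnit hu.eventually_norm w) k
  have smear_mem : ∀ e, (gaussianSmear γ e 0, gaussianSmear γ e z) ∈ analyticGraph γ z := by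
    intro e
    simpa only [zero_add] using (isEntireOrbit_gaussianSmear hγ e).mem_analyticGraph 0 z
  exact mem_closure_of_tendsto ((lim 0 m).prodMk_nhds (lim z n)) (.of_forall fun e =>
    ⟨_, ((mem_strictGraph_iff hα hm hβ hγ).1 hmn).1 _ _ (smear_mem e), rfl⟩)

theorem map_analyticGraph_le_strictGraph (hα : α.SemiMultiplicative) (z : ℂ) :
    (analyticGraph α z).map ((embed A).prodMap (embed A)) ≤ strictGraph hα z := by
  rintro _ ⟨⟨a, _⟩, ⟨f, hf, rfl⟩, rfl⟩
  refine ⟨fun y => (f y : 𝓜(ℂ, A)), ⟨fun y hy => tendsto_strict_iff.2 ⟨fun x => ?_, fun x => ?_⟩,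
    analyticOnNhd_of_fst isOpen_interior
      ((ContinuousLinearMap.mul ℂ A).comp_analyticOnNhd hf.analyticOn), fun t => ?_⟩, rfl⟩
  · exact (hf.continuousOn y hy).mul continuousWithinAt_const
  · exact continuousWithinAt_const.mul (hf.continuousOn y hy)
  · rw [← hf.eq_real]
    exact (isStrictExtension_strictExt hα t).extends_coe a

theorem topologicalClosure_embedOperator_graph (hα : α.SemiMultiplicative) (z : ℂ) :
    (embedOperator (analyticCont α z)).graph.topologicalClosure = (strictCont hα z).graph := by
  rw [embedOperator_graph, analyticCont_graph, strictCont_graph]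
  exact le_antisymm (Submodule.topologicalClosure_minimal _ (map_analyticGraph_le_strictGraph hα z)
    (isClosed_strictGraph hα z)) (strictGraph_le_topologicalClosure hα z)

theorem isClosable_embedOperator (hα : α.SemiMultiplicative) (z : ℂ) :
    (embedOperator (analyticCont α z)).IsClosable :=
  ⟨_, topologicalClosure_embedOperator_graph hα z⟩

theorem closure_embedOperator (hα : α.SemiMultiplicative) (z : ℂ) :
    (embedOperator (analyticCont α z)).closure = strictCont hα z :=
  LinearPMap.eq_of_eq_graph
    ((isClosable_embedOperator hα z).graph_closure_eq_closure_graph.symm.trans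
      (topologicalClosure_embedOperator_graph hα z))

theorem embedOperator_domain (T : A →ₗ.[ℂ] A) :
    (embedOperator T).domain = T.domain.map (embed A) := by
  rw [← LinearPMap.graph_map_fst_eq_domain, ← LinearPMap.graph_map_fst_eq_domain,
    embedOperator_graph, ← Submodule.map_comp, ← Submodule.map_comp]
  rfl

theorem isClosed_strictCont (hα : α.SemiMultiplicative) (z : ℂ) : (strictCont hα z).IsClosed := by
  rw [LinearPMap.IsClosed, strictCont_graph]
  exact isClosed_strictGraph hα z

theorem hasCore_strictCont (hα : α.SemiMultiplicative) (z : ℂ) :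
    (strictCont hα z).HasCore ((analyticCont α z).domain.map (embed A)) := by
  rw [← closure_embedOperator hα z, ← embedOperator_domain]
  exact LinearPMap.closureHasCore _

end Core

end StrictContinuation

theorem theorem2p4_general {A : Type*} [NonUnitalCStarAlgebra A]
    {α : StrictContinuation.OneParamRep A} (hα : α.SemiMultiplicative) (z : ℂ) :
    (StrictContinuation.strictCont hα z).IsClosed ∧
    (StrictContinuation.strictCont hα z).HasCore
      ((StrictContinuation.analyticCont α z).domain.map (StrictContinuation.embed A)) ∧
    (StrictContinuation.embedOperator (StrictContinuation.analyticCont α z)).IsClosable ∧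
    (StrictContinuation.embedOperator (StrictContinuation.analyticCont α z)).closure =
      StrictContinuation.strictCont hα z :=
  ⟨StrictContinuation.isClosed_strictCont hα z, StrictContinuation.hasCore_strictCont hα z,
    StrictContinuation.isClosable_embedOperator hα z, StrictContinuation.closure_embedOperator hα z⟩

/-- Let `α` be a strongly continuous, semi-multiplicative one-parameter representation on a
C⋆-algebra `A`. For every `z`, the strict analytic continuation at `z` is a strictly closed operator
in `M(A)`, has `D(α_z)` as a strict core, and equals the strict closure of the (strictly closable)
operator `α_z`. -/
theorem theorem2p4 {A : Type*} [NonUnitalCStarAlgebra A] (α : StrictContinuation.OneParamRep A)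
    (hcont : α.StronglyContinuous) (hα : α.SemiMultiplicative) (z : ℂ) :
    (StrictContinuation.strictCont hα z).IsClosed ∧
    (StrictContinuation.strictCont hα z).HasCore
      ((StrictContinuation.analyticCont α z).domain.map (StrictContinuation.embed A)) ∧
    (StrictContinuation.embedOperator (StrictContinuation.analyticCont α z)).IsClosable ∧
    (StrictContinuation.embedOperator (StrictContinuation.analyticCont α z)).closure =
      StrictContinuation.strictCont hα z := by
  exact theorem2p4_general hα z
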